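/- Let $H$ be a complex Hilbert space, let $C_1,\ldots,C_L$ be bounded positive semi-definite operators on $H$, and let $p>q\ge 1$ be real numbers. For $r\ge 1$ and a bounded operator $X$ on $H$ let $\|X\|_r=(\operatorname{Tr}|X|^r)^{1/r}\in[0,\infty]$ be the Schatten $r$-norm, where $|X|=(X^*X)^{1/2}$. For $\operatorname{Re} z>0$ let $C_i^{z}$ be the operator obtained by applying the function $x\mapsto x^{z}$ (with $0^z=0$) to $C_i$ by the functional calculus. For $\theta\in(0,1)$ and $t\in\mathbb{R}$ put $$\beta_\theta(t)=\frac{\sin(\pi\theta)}{2\theta\,[\cosh(\pi t)+\cos(\pi\theta)]}.$$ Then $\beta_{q/p}$ is a probability density on $\mathbb{R}$, that is, $\beta_{q/p}\ge 0$ and $\int_{-\infty}^{\infty}\beta_{q/p}(t)\,dt=1$, and $$\log\left\|C_1^{1/p}C_2^{1/p}\cdots C_L^{1/p}\right\|_p^p\;\le\;\int_{-\infty}^{\infty}\beta_{q/p}(t)\,\log\left\|C_1^{(1+it)/q}C_2^{(1+it)/q}\cdots C_L^{(1+it)/q}\right\|_q^q\,dt .$$ Both sides are elements of $[-\infty,\infty]$,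 with $\log 0=-\infty$ and $\log\infty=\infty$, and the integral is the integral of the positive part minus the integral of the negative part (with $\infty-\infty$ read as $-\infty$). -/

import Mathlib

open MeasureTheory
open scoped ENNReal InnerProductSpace

noncomputable section

/-- The function `β_θ(t) = sin(πθ) / (2θ [cosh(πt) + cos(πθ)])`. -/
def betaDensity (θ t : ℝ) : ℝ :=
  Real.sin (Real.pi * θ) /
    (2 * θ * (Real.cosh (Real.pi * t) + Real.cos (Real.pi * θ)))

section Operators

variable {H : Type*} [NormedAddCommGroup H] [InnerProductSpace ℂ H] [CompleteSpace H]

/-- The power `C ^ z` of a positive operator `C` for `Re z > 0`: the continuous functional calculus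
of `C` applied to `x ↦ x ^ z` (with `0 ^ z = 0`), which is continuous on `[0, ∞)`. -/
def opPow (C : H →L[ℂ] H) (z : ℂ) : H →L[ℂ] H :=
  cfc (fun x : ℂ => x ^ z) C

/-- The ordered product `C₁ ^ z ⋯ C_L ^ z`. -/
def chainPow {L : ℕ} (C : Fin L → H →L[ℂ] H) (z : ℂ) : H →L[ℂ] H :=
  (List.ofFn fun i => opPow (C i) z).prod

/-- The trace `∑ᵢ ⟨eᵢ, T eᵢ⟩ ∈ [0, ∞]` of a positive operator, over an orthonormal basis of `H`
(see `posTrace_eq_tsum`: every orthonormal basis gives the same value). -/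
def posTrace (T : H →L[ℂ] H) : ℝ≥0∞ :=
  ∑' e : (exists_hilbertBasis ℂ H).choose, ENNReal.ofReal (RCLike.re ⟪(e : H), T e⟫_ℂ)

/-- Parseval's identity in `[0, ∞]`. -/
theorem enorm_sq_eq_tsum {ι : Type*} (b : HilbertBasis ι ℂ H) (x : H) :
    ENNReal.ofReal (‖x‖ ^ 2) = ∑' i, ENNReal.ofReal (‖⟪b i, x⟫_ℂ‖ ^ 2) := by
  have h := (b.hasSum_inner_mul_inner x x).mapL (Complex.reCLM)
  have h2 : HasSum (fun i => ‖⟪b i, x⟫_ℂ‖ ^ 2) (‖x‖ ^ 2) := by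
    convert h using 1
    · funext i
      rw [← inner_conj_symm x (b i)]
      simp only [Complex.reCLM_apply]
      rw [← Complex.normSq_eq_conj_mul_self, Complex.normSq_eq_norm_sq, Complex.ofReal_re]
    · rw [inner_self_eq_norm_sq_to_K]
      simp [← Complex.ofReal_pow]
  rw [← h2.tsum_eq, ENNReal.ofReal_tsum_of_nonneg (fun i => by positivity) h2.summable]

theorem tsum_enorm_sq_adjoint {ι κ : Type*} (b : HilbertBasis ι ℂ H) (c : HilbertBasis κ ℂ H)
    (S : H →L[ℂ] H) :
    ∑' i, ENNReal.ofReal (‖S (b i)‖ ^ 2) =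
      ∑' j, ENNReal.ofReal (‖(ContinuousLinearMap.adjoint S) (c j)‖ ^ 2) := by
  simp_rw [enorm_sq_eq_tsum c (S _), enorm_sq_eq_tsum b (ContinuousLinearMap.adjoint S _)]
  rw [ENNReal.tsum_comm]
  refine tsum_congr fun j => tsum_congr fun i => ?_
  rw [ContinuousLinearMap.adjoint_inner_right, norm_inner_symm]

/-- The trace of a positive operator may be computed in any orthonormal basis. -/
theorem posTrace_eq_tsum {ι : Type*} (b : HilbertBasis ι ℂ H) {T : H →L[ℂ] H}
    (hT : T.IsPositive) :
    posTrace T = ∑' i, ENNReal.ofReal (RCLike.re ⟪b i, T (b i)⟫_ℂ) := by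
  obtain ⟨S, rfl⟩ := CStarAlgebra.nonneg_iff_eq_star_mul_self.mp
    (ContinuousLinearMap.nonneg_iff_isPositive T |>.mpr hT)
  have key : ∀ x : H, RCLike.re ⟪x, (star S * S) x⟫_ℂ = ‖S x‖ ^ 2 := fun x => by
    rw [ContinuousLinearMap.star_eq_adjoint, mul_apply_eq_comp,
      ContinuousLinearMap.adjoint_inner_right, inner_self_eq_norm_sq]
  obtain ⟨c, hc⟩ := (exists_hilbertBasis ℂ H).choose_spec
  have h1 : posTrace (star S * S) = ∑' i, ENNReal.ofReal (‖S (c i)‖ ^ 2) := by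
    unfold posTrace
    simp_rw [key, hc]
  rw [h1]
  simp_rw [key]
  rw [tsum_enorm_sq_adjoint c c, ← tsum_enorm_sq_adjoint b c]

/-- The Schatten norm `‖X‖_p = (Tr |X| ^ p) ^ (1/p) ∈ [0, ∞]`, where `|X| = (X* X) ^ (1/2)`. -/
def schattenNorm (p : ℝ) (X : H →L[ℂ] H) : ℝ≥0∞ :=
  posTrace (cfc (fun x : ℝ => x ^ p) (CFC.abs X)) ^ (1 / p)

end Operators

/-- The Lebesgue integral over the real line of an extended-real function, as the integral of the
positive part minus that of the negative part (with `∞ - ∞ = -∞`). -/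
def extIntegral (f : ℝ → EReal) : EReal :=
  ((∫⁻ t, (f t).toENNReal : ℝ≥0∞) : EReal) - ((∫⁻ t, (-f t).toENNReal : ℝ≥0∞) : EReal)

end

/-!
The proof is complex interpolation between the operator norm on `Re z = 0` and the Schatten norm of
order `q` on `Re z = 1`, for the holomorphic family `G z = C₁ ^ (z / q) ⋯ C_L ^ (z / q)`, evaluated at
`θ = q / p`, with Hirschman's sharpening of the three lines lemma: the supremum over `Re z = 1` is
replaced by the mean of the logarithm against harmonic measure, which has density `θ β_θ`.

Operators are reduced to finitely many scalar functions by a variational description of the trace,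
for arbitrary bounded `X`, compact or not, and `p ≥ 1`: `Tr |X| ^ p` is the supremum of
`∑ ‖⟪V (e i), X (e i)⟫‖ ^ p` over finite orthonormal families `e` and contractions `V`. The upper bound
`sum_norm_inner_rpow_le_posTrace` rests on Jensen's inequality; the lower bound
`exists_lt_sum_norm_inner_rpow` takes for `e` eigenvectors of a finite rank operator below `|X| ^ p` and
uses that the `p`-th root is operator monotone. For `h i z = ⟪V (e i), G z (e i)⟫` it remains to bound
`log ∑ ‖h i θ‖ ^ p` by the mean of `log ∑ ‖h i (1 + it)‖ ^ q`, which is `log_sum_rpow_le_integral`.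

Hirschman's lemma `log_norm_le_integral_betaDensity` comes from Jensen's formula on circles of radius
`r < 1`, transported by the conformal map `diskToStrip` of the disk onto the strip, as `r → 1`. The
angular variable on the arc that corresponds to `Re z = 1` has derivative `2πθ β_θ`
(`hasDerivAt_boundaryAngle`), which also shows that `β_θ` is a probability density. Logarithms are cut
off from below at a level `ε > 0` until `coe_le_extIntegral` lets `ε → 0` and returns to integrals in
`[-∞, ∞]`.
-/

/-! ### Matrix entries and the trace: the upper bound -/

section Operators

variable {H : Type*} [NormedAddCommGroup H] [InnerProductSpace ℂ H] [CompleteSpace H]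

/-- An approximate polar decomposition: the contraction `U = Y (|Y| + ε)⁻¹` satisfies `Y ≈ U |Y|` and
`U* Y ≈ |Y|` up to `ε` in norm. Both halves of the variational description of the trace of
`|Y| ^ q` need no more than this. -/
theorem exists_contraction_approx_polar (Y : H →L[ℂ] H) {ε : ℝ} (hε : 0 < ε) :
    ∃ U : H →L[ℂ] H, ‖U‖ ≤ 1 ∧ ‖Y - U * CFC.abs Y‖ ≤ ε ∧ ‖star U * Y - CFC.abs Y‖ ≤ ε := by
  set A := CFC.abs Y with hA
  have hA0 : 0 ≤ A := CFC.abs_nonneg Y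
  have hAA : A * A = star Y * Y := CFC.abs_mul_abs Y
  have hsa : IsSelfAdjoint A := IsSelfAdjoint.of_nonneg hA0
  have hspec : ∀ x ∈ spectrum ℝ A, 0 ≤ x := fun x hx => spectrum_nonneg_of_nonneg hA0 hx
  have hc : ContinuousOn (fun x : ℝ => (x + ε)⁻¹) (spectrum ℝ A) :=
    ContinuousOn.inv₀ (by fun_prop) fun x hx => by have := hspec x hx; positivity
  set R := cfc (fun x : ℝ => (x + ε)⁻¹) A with hR
  have hRsa : star R = R := (cfc_predicate (fun x : ℝ => (x + ε)⁻¹) A : IsSelfAdjoint R)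
  have hRA' : R * A = cfc (fun x : ℝ => (x + ε)⁻¹ * x) A := by
    rw [cfc_mul (fun x : ℝ => (x + ε)⁻¹) (fun x => x) A hc continuousOn_id, cfc_id' ℝ A]
  have hAR : A * R = R * A := by
    have := cfc_mul (fun x : ℝ => x) (fun x : ℝ => (x + ε)⁻¹) A continuousOn_id hc
    rw [cfc_id' ℝ A] at this
    rw [hRA', ← this]
    simp only [mul_comm]
  have hRA : ‖R * A‖ ≤ 1 := by
    rw [hRA']
    refine norm_cfc_le zero_le_one fun x hx => ?_
    have h0 := hspec x hx
    rw [Real.norm_of_nonneg (by positivity), inv_mul_le_iff₀ (by positivity)]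
    linarith
  have hone : R * A + ε • R = 1 := by
    rw [hRA', hR, ← cfc_const_mul ε _ A hc, ← cfc_add A _ _ (by fun_prop) (by fun_prop),
      ← cfc_one ℝ A]
    refine cfc_congr fun x hx => ?_
    have h0 := hspec x hx
    have : x + ε ≠ 0 := by positivity
    simp only [Pi.one_apply]
    field_simp
  have hεR : ε • R = 1 - R * A := eq_sub_of_add_eq' hone
  have hU : ‖Y * R‖ ≤ 1 := by
    have h1 : star (Y * R) * (Y * R) = (R * A) * (R * A) := by
      rw [star_mul, hRsa, mul_assoc, ← mul_assoc (star Y), ← hAA]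
      rw [← hAR]
      simp only [mul_assoc]
      rw [← mul_assoc R A, ← hAR]
      simp only [mul_assoc]
    have h2 : ‖Y * R‖ * ‖Y * R‖ ≤ 1 := by
      rw [← CStarRing.norm_star_mul_self, h1]
      exact (norm_mul_le _ _).trans (mul_le_one₀ hRA (norm_nonneg _) hRA)
    nlinarith [norm_nonneg (Y * R)]
  refine ⟨Y * R, hU, ?_, ?_⟩
  · have : Y - Y * R * A = ε • (Y * R) := by
      rw [← mul_smul_comm, hεR, mul_sub, mul_one, mul_assoc]
    rw [this, norm_smul, Real.norm_of_nonneg hε.le]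
    exact mul_le_of_le_one_right hε.le hU
  · have : star (Y * R) * Y - A = -(ε • (R * A)) := by
      rw [star_mul, hRsa, mul_assoc, ← hAA, ← smul_mul_assoc, hεR]
      noncomm_ring
    rw [this, norm_neg, norm_smul, Real.norm_of_nonneg hε.le]
    exact mul_le_of_le_one_right hε.le hRA

/-- Jensen's inequality for a vector of norm at most one: by the functional calculus `A ^ q` lies above
the tangent line of `s ↦ s ^ q` at `l = ⟪x, A x⟫`. -/
theorem rpow_inner_le_inner_cfc_rpow {A : H →L[ℂ] H} (hA : 0 ≤ A) {q : ℝ} (hq : 1 ≤ q) {x : H}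
    (hx : ‖x‖ ≤ 1) :
    RCLike.re ⟪x, A x⟫_ℂ ^ q ≤ RCLike.re ⟪x, cfc (fun s : ℝ => s ^ q) A x⟫_ℂ := by
  have hsa : IsSelfAdjoint A := IsSelfAdjoint.of_nonneg hA
  have hspec : ∀ s ∈ spectrum ℝ A, 0 ≤ s := fun x hx => spectrum_nonneg_of_nonneg hA hx
  have hpos : (0:ℝ) ≤ RCLike.re ⟪x, A x⟫_ℂ :=
    ((ContinuousLinearMap.nonneg_iff_isPositive A).1 hA).re_inner_nonneg_right x
  set l : ℝ := RCLike.re ⟪x, A x⟫_ℂ with hl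
  have hcont : ContinuousOn (fun s : ℝ => s ^ q) (spectrum ℝ A) :=
    (Real.continuous_rpow_const (by linarith)).continuousOn
  rcases hpos.eq_or_lt with h0 | h0
  · rw [← h0, Real.zero_rpow (by linarith)]
    have : 0 ≤ cfc (fun s : ℝ => s ^ q) A := cfc_nonneg fun s hs => Real.rpow_nonneg (hspec s hs) _
    exact ((ContinuousLinearMap.nonneg_iff_isPositive _).1 this).re_inner_nonneg_right x
  have hline : ((1 - q) * l ^ q) • (1 : H →L[ℂ] H) + (q * l ^ (q - 1)) • A ≤
      cfc (fun s : ℝ => s ^ q) A := by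
    have : ((1 - q) * l ^ q) • (1 : H →L[ℂ] H) + (q * l ^ (q - 1)) • A =
        cfc (fun s : ℝ => (1 - q) * l ^ q + q * l ^ (q - 1) * s) A := by
      rw [cfc_add A _ _, cfc_const _ A, cfc_const_mul_id _ A, Algebra.algebraMap_eq_smul_one]
    rw [this]
    refine cfc_mono fun s hs => ?_
    -- Bernoulli's inequality at `s / l`, multiplied by `l ^ q`
    have hs0 := hspec s hs
    have hb := one_add_mul_self_le_rpow_one_add (s := s / l - 1)
      (by have : 0 ≤ s / l := by positivity
          linarith) hq
    rw [show 1 + (s / l - 1) = s / l by ring, Real.div_rpow hs0 h0.le,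
      le_div_iff₀ (by positivity)] at hb
    have : l ^ q = l ^ (q - 1) * l := by
      rw [← Real.rpow_add_one h0.ne']; ring_nf
    refine le_trans (le_of_eq ?_) hb
    rw [this]
    field_simp
    ring
  have h := ((ContinuousLinearMap.le_def _ _).1 hline).re_inner_nonneg_right x
  simp only [sub_apply, add_apply,
    smul_apply, inner_sub_right, inner_add_right, map_sub, map_add] at h
  have e1 : RCLike.re ⟪x, ((1 - q) * l ^ q) • (1 : H →L[ℂ] H) x⟫_ℂ =
      ((1 - q) * l ^ q) * ‖x‖ ^ 2 := by
    rw [inner_smul_right_eq_smul, RCLike.smul_re]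
    simp [inner_self_eq_norm_sq_to_K, ← Complex.ofReal_pow]
  have e2 : RCLike.re ⟪x, (q * l ^ (q - 1)) • A x⟫_ℂ = q * l ^ q := by
    rw [inner_smul_right_eq_smul, RCLike.smul_re, ← hl, mul_assoc, ← Real.rpow_add_one h0.ne']
    ring_nf
  rw [e1, e2] at h
  have hx2 : ‖x‖ ^ 2 ≤ 1 := pow_le_one₀ (norm_nonneg _) hx
  have hlq : 0 ≤ (q - 1) * l ^ q := mul_nonneg (by linarith) (by positivity)
  nlinarith [mul_nonneg hlq (sub_nonneg.2 hx2)]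


/-- An orthonormal family moved by a contraction `W` sees at most the whole trace, since
`Tr (W* D W) ≤ Tr D`. -/
theorem sum_inner_le_posTrace {D : H →L[ℂ] H} (hD : 0 ≤ D) {ι : Type*} [Fintype ι] {e : ι → H}
    (he : Orthonormal ℂ e) {W : H →L[ℂ] H} (hW : ‖W‖ ≤ 1) :
    ∑ i, ENNReal.ofReal (RCLike.re ⟪W (e i), D (W (e i))⟫_ℂ) ≤ posTrace D := by
  obtain ⟨w, b, hw, hb⟩ := he.toSubtypeRange.exists_hilbertBasis_extension
  rw [posTrace_eq_tsum b ((ContinuousLinearMap.nonneg_iff_isPositive D).1 hD)]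
  obtain ⟨S, rfl⟩ := CStarAlgebra.nonneg_iff_eq_star_mul_self.mp hD
  have key : ∀ x : H, RCLike.re ⟪x, (star S * S) x⟫_ℂ = ‖S x‖ ^ 2 := fun x => by
    rw [ContinuousLinearMap.star_eq_adjoint, mul_apply_eq_comp,
      ContinuousLinearMap.adjoint_inner_right, inner_self_eq_norm_sq]
  simp_rw [key]
  have hinj : Function.Injective (fun i => (⟨e i, hw ⟨i, rfl⟩⟩ : w)) := fun i j hij =>
    he.linearIndependent.injective (congrArg Subtype.val hij)
  calc ∑ i, ENNReal.ofReal (‖S (W (e i))‖ ^ 2)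
      = ∑' i, ENNReal.ofReal (‖(S * W) (b ⟨e i, hw ⟨i, rfl⟩⟩)‖ ^ 2) := by
        rw [tsum_fintype]; simp [hb]
    _ ≤ ∑' j, ENNReal.ofReal (‖(S * W) (b j)‖ ^ 2) :=
        ENNReal.tsum_comp_le_tsum_of_injective hinj
          (fun j => ENNReal.ofReal (‖(S * W) (b j)‖ ^ 2))
    _ = ∑' j, ENNReal.ofReal (‖(star W * star S) (b j)‖ ^ 2) := by
        rw [tsum_enorm_sq_adjoint b b, ← ContinuousLinearMap.star_eq_adjoint, star_mul]
    _ ≤ ∑' j, ENNReal.ofReal (‖(star S) (b j)‖ ^ 2) := by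
        refine ENNReal.tsum_le_tsum fun j => ENNReal.ofReal_le_ofReal ?_
        gcongr
        refine ((star W).le_opNorm _).trans (mul_le_of_le_one_left (norm_nonneg _) ?_)
        rwa [norm_star]
    _ = ∑' j, ENNReal.ofReal (‖S (b j)‖ ^ 2) := by
        rw [tsum_enorm_sq_adjoint b b S, ContinuousLinearMap.star_eq_adjoint]

theorem sum_rpow_inner_le_posTrace {A : H →L[ℂ] H} (hA : 0 ≤ A) {q : ℝ} (hq : 1 ≤ q) {ι : Type*}
    [Fintype ι] {e : ι → H} (he : Orthonormal ℂ e) {W : H →L[ℂ] H} (hW : ‖W‖ ≤ 1) :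
    ∑ i, ENNReal.ofReal (RCLike.re ⟪W (e i), A (W (e i))⟫_ℂ ^ q) ≤
      posTrace (cfc (fun s : ℝ => s ^ q) A) := by
  have h0 : 0 ≤ cfc (fun s : ℝ => s ^ q) A :=
    cfc_nonneg fun s hs => Real.rpow_nonneg (spectrum_nonneg_of_nonneg hA hs) _
  refine le_trans (Finset.sum_le_sum fun i _ => ENNReal.ofReal_le_ofReal ?_)
    (sum_inner_le_posTrace h0 he hW)
  refine rpow_inner_le_inner_cfc_rpow hA hq ?_
  refine (W.le_opNorm _).trans ?_
  rw [he.1 i, mul_one]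
  exact hW

/-- The Cauchy-Schwarz inequality for the form `⟪x, A y⟫`, followed by the inequality of arithmetic and
geometric means. -/
theorem norm_inner_rpow_le_half_add {A : H →L[ℂ] H} (hA : 0 ≤ A) {q : ℝ} (hq : 0 ≤ q) (x y : H) :
    ‖⟪x, A y⟫_ℂ‖ ^ q ≤
      (RCLike.re ⟪x, A x⟫_ℂ ^ q + RCLike.re ⟪y, A y⟫_ℂ ^ q) / 2 := by
  obtain ⟨S, rfl⟩ := CStarAlgebra.nonneg_iff_eq_star_mul_self.mp hA
  have key : ∀ x : H, RCLike.re ⟪x, (star S * S) x⟫_ℂ = ‖S x‖ ^ 2 := fun x => by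
    rw [ContinuousLinearMap.star_eq_adjoint, mul_apply_eq_comp,
      ContinuousLinearMap.adjoint_inner_right, inner_self_eq_norm_sq]
  rw [key, key, ContinuousLinearMap.star_eq_adjoint, mul_apply_eq_comp,
      ContinuousLinearMap.adjoint_inner_right]
  have h1 : ‖⟪S x, S y⟫_ℂ‖ ^ q ≤ ‖S x‖ ^ q * ‖S y‖ ^ q := by
    rw [← Real.mul_rpow (norm_nonneg _) (norm_nonneg _)]
    exact Real.rpow_le_rpow (norm_nonneg _) (norm_inner_le_norm _ _) hq
  have h2 : ∀ z : H, (‖S z‖ ^ 2) ^ q = (‖S z‖ ^ q) ^ 2 := fun z => by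
    rw [← Real.rpow_natCast, ← Real.rpow_natCast, ← Real.rpow_mul (norm_nonneg _),
      ← Real.rpow_mul (norm_nonneg _), mul_comm]
  rw [h2, h2]
  nlinarith [sq_nonneg (‖S x‖ ^ q - ‖S y‖ ^ q)]

/-- The upper bound in the variational description of `Tr |Y| ^ q`: matrix entries of `Y` between an
orthonormal family and its image under a contraction have `q`-th powers summing to at most
`Tr |Y| ^ q`. With `Y ≈ U |Y|`, each entry is an entry of `|Y|` between `U* V e` and `e`. -/
theorem sum_norm_inner_rpow_le_posTrace (Y : H →L[ℂ] H) {q : ℝ} (hq : 1 ≤ q) {ι : Type*}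
    [Fintype ι] {e : ι → H} (he : Orthonormal ℂ e) {V : H →L[ℂ] H} (hV : ‖V‖ ≤ 1) :
    ENNReal.ofReal (∑ i, ‖⟪V (e i), Y (e i)⟫_ℂ‖ ^ q) ≤
      posTrace (cfc (fun s : ℝ => s ^ q) (CFC.abs Y)) := by
  have hq0 : 0 ≤ q := by linarith
  set T := posTrace (cfc (fun s : ℝ => s ^ q) (CFC.abs Y))
  have hA := CFC.abs_nonneg Y
  choose U hU1 hU2 hU3 using fun n : ℕ =>
    exists_contraction_approx_polar Y (Nat.one_div_pos_of_nat (α := ℝ) (n := n))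
  have hlim : Filter.Tendsto (fun n => U n * CFC.abs Y) Filter.atTop (nhds Y) := by
    rw [tendsto_iff_norm_sub_tendsto_zero]
    refine squeeze_zero (fun _ => norm_nonneg _) (fun n => ?_)
      (tendsto_one_div_add_atTop_nhds_zero_nat (𝕜 := ℝ))
    rw [norm_sub_rev]
    exact hU2 n
  have hlim2 : Filter.Tendsto
      (fun n => ENNReal.ofReal (∑ i, ‖⟪V (e i), (U n * CFC.abs Y) (e i)⟫_ℂ‖ ^ q)) Filter.atTop
      (nhds (ENNReal.ofReal (∑ i, ‖⟪V (e i), Y (e i)⟫_ℂ‖ ^ q))) := by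
    have hcont : Continuous fun Z : H →L[ℂ] H =>
        ENNReal.ofReal (∑ i, ‖⟪V (e i), Z (e i)⟫_ℂ‖ ^ q) := by
      refine ENNReal.continuous_ofReal.comp (continuous_finsetSum _ fun i _ => ?_)
      refine (Continuous.rpow_const ?_ fun _ => Or.inr hq0)
      exact (Continuous.inner continuous_const (by fun_prop)).norm
    exact (hcont.tendsto Y).comp hlim
  refine le_of_tendsto' hlim2 fun n => ?_
  have hW : ‖star (U n) * V‖ ≤ 1 := by
    refine (norm_mul_le _ _).trans (mul_le_one₀ ?_ (norm_nonneg _) hV)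
    rw [norm_star]
    exact hU1 n
  have h1 : ‖(1 : H →L[ℂ] H)‖ ≤ 1 := ContinuousLinearMap.norm_id_le
  have hnn : ∀ x : H, 0 ≤ RCLike.re ⟪x, CFC.abs Y x⟫_ℂ :=
    ((ContinuousLinearMap.nonneg_iff_isPositive _).1 hA).re_inner_nonneg_right
  calc ENNReal.ofReal (∑ i, ‖⟪V (e i), (U n * CFC.abs Y) (e i)⟫_ℂ‖ ^ q)
      ≤ ENNReal.ofReal (∑ i, (RCLike.re ⟪(star (U n) * V) (e i),
            CFC.abs Y ((star (U n) * V) (e i))⟫_ℂ ^ q +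
          RCLike.re ⟪(1 : H →L[ℂ] H) (e i), CFC.abs Y ((1 : H →L[ℂ] H) (e i))⟫_ℂ ^ q) / 2) := by
        refine ENNReal.ofReal_le_ofReal (Finset.sum_le_sum fun i _ => ?_)
        refine le_trans (le_of_eq ?_)
          (norm_inner_rpow_le_half_add hA hq0 ((star (U n) * V) (e i)) (e i))
        rw [mul_apply_eq_comp, mul_apply_eq_comp, ContinuousLinearMap.star_eq_adjoint,
          ContinuousLinearMap.adjoint_inner_left]
    _ = (∑ i, ENNReal.ofReal (RCLike.re ⟪(star (U n) * V) (e i),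
            CFC.abs Y ((star (U n) * V) (e i))⟫_ℂ ^ q) +
          ∑ i, ENNReal.ofReal (RCLike.re ⟪(1 : H →L[ℂ] H) (e i),
            CFC.abs Y ((1 : H →L[ℂ] H) (e i))⟫_ℂ ^ q)) / 2 := by
        rw [← Finset.sum_div, ENNReal.ofReal_div_of_pos two_pos, Finset.sum_add_distrib,
          ENNReal.ofReal_add, ENNReal.ofReal_sum_of_nonneg, ENNReal.ofReal_sum_of_nonneg]
        · simp
        all_goals
          first
          | exact fun i _ => Real.rpow_nonneg (hnn _) _
          | exact Finset.sum_nonneg fun i _ => Real.rpow_nonneg (hnn _) _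
    _ ≤ (T + T) / 2 := by
        gcongr
        · exact sum_rpow_inner_le_posTrace hA hq he hW
        · exact sum_rpow_inner_le_posTrace hA hq he h1
    _ = T := by
        rw [← two_mul, mul_comm, ENNReal.mul_div_cancel_right two_ne_zero ENNReal.ofNat_ne_top]

/-! ### Matrix entries and the trace: the lower bound -/

/-- An orthonormal basis of the span of a finite orthonormal family `b` in which the compression of the
self-adjoint operator `D` is diagonal. -/
theorem exists_orthonormal_diagonalizing {D : H →L[ℂ] H} (hD : IsSelfAdjoint D) {ι : Type*}
    [Fintype ι] {b : ι → H} (hb : Orthonormal ℂ b) :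
    ∃ (n : ℕ) (v : Fin n → H) (κ : Fin n → ℝ), Orthonormal ℂ v ∧
      (∀ i j, ⟪v i, D (v j)⟫_ℂ = if i = j then (κ j : ℂ) else 0) ∧
      ∑ i, κ i = ∑ i, RCLike.re ⟪b i, D (b i)⟫_ℂ := by
  let E := Submodule.span ℂ (Set.range b)
  have : FiniteDimensional ℂ E := FiniteDimensional.span_of_finite ℂ (Set.finite_range b)
  let T : E →ₗ[ℂ] E := (E.orthogonalProjectionOnto ∘L D ∘L E.subtypeL : E →L[ℂ] E)
  have hT' : ∀ x y : E, ⟪x, T y⟫_ℂ = ⟪(x : H), D y⟫_ℂ := fun x y => by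
    simp [T]
  have hT : T.IsSymmetric := fun x y => by
    rw [hT', ← inner_conj_symm, hT', inner_conj_symm]
    exact (ContinuousLinearMap.isSelfAdjoint_iff_isSymmetric.1 hD) x y
  let w : ι → E := fun i => ⟨b i, Submodule.subset_span ⟨i, rfl⟩⟩
  have hw : Orthonormal ℂ w := by
    have : Orthonormal ℂ (E.subtypeₗᵢ ∘ w) := hb
    rwa [LinearIsometry.orthonormal_comp_iff] at this
  have hsp : ⊤ ≤ Submodule.span ℂ (Set.range w) := by
    exact ((Submodule.span_range_subtype_eq_top_iff E fun i => (w i).2).2 rfl).ge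
  let B := OrthonormalBasis.mk hw hsp
  refine ⟨Module.finrank ℂ E, fun i => (hT.eigenvectorBasis rfl i : H), hT.eigenvalues rfl,
    ?_, fun i j => ?_, ?_⟩
  · exact (hT.eigenvectorBasis rfl).orthonormal.comp_linearIsometry E.subtypeₗᵢ
  · rw [← hT', hT.apply_eigenvectorBasis, inner_smul_right,
      orthonormal_iff_ite.1 (hT.eigenvectorBasis rfl).orthonormal]
    simp
  · rw [← hT.re_trace_eq_sum_eigenvalues, LinearMap.trace_eq_sum_inner T B]
    simp [B, hT', w]

/-- The functional calculus on an eigenvector. As `dslope f κ` is continuous, `f(K) - f(κ)` is a multiple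
of `K - κ`. -/
theorem cfc_apply_of_apply_eq_smul {K : H →L[ℂ] H} (hK : IsSelfAdjoint K) {f : ℝ → ℝ}
    (hf : Continuous f) {κ : ℝ} (hd : DifferentiableAt ℝ f κ) {e : H} (he : K e = κ • e) :
    cfc f K e = f κ • e := by
  have hc : Continuous (dslope f κ) := by
    rw [← continuousOn_univ] at hf ⊢
    exact (continuousOn_dslope Filter.univ_mem).2 ⟨hf, hd⟩
  have h1 : cfc f K = cfc (dslope f κ) K * (K - κ • (1 : H →L[ℂ] H)) + f κ • (1 : H →L[ℂ] H) := by
    have h2 : f = fun x => dslope f κ x * (x - κ) + f κ := by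
      funext x
      have := sub_smul_dslope f κ x
      rw [smul_eq_mul, mul_comm] at this
      rw [this]
      ring
    conv_lhs => rw [h2]
    rw [cfc_add K _ _ (by fun_prop) (by fun_prop), cfc_mul _ _ K (by fun_prop) (by fun_prop),
      cfc_sub (fun x => x) (fun _ => κ) K, cfc_id' ℝ K, cfc_const _ K, cfc_const _ K,
      Algebra.algebraMap_eq_smul_one, Algebra.algebraMap_eq_smul_one]
  rw [h1]
  simp [he]

/-- If `K ≤ A ^ p` and `e` is a unit eigenvector of `K`, the operator monotonicity of the `p`-th root
bounds the eigenvalue from above by `⟪e, A e⟫ ^ p`. -/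
theorem rpow_le_inner_of_le_cfc_rpow {A : H →L[ℂ] H} (hA : 0 ≤ A) {p : ℝ} (hp : 1 ≤ p)
    {K : H →L[ℂ] H} (hK : 0 ≤ K) (hKA : K ≤ cfc (fun s : ℝ => s ^ p) A) {κ : ℝ} (hκ : 0 < κ) {e : H}
    (he : ‖e‖ = 1) (hKe : K e = κ • e) : κ ^ (1 / p) ≤ RCLike.re ⟪e, A e⟫_ℂ := by
  have hp0 : 0 < p := by linarith
  have h1 : K ^ (1 / p) ≤ A := by
    have := CFC.rpow_le_rpow (p := 1 / p) ⟨by positivity, by rw [div_le_one hp0]; exact hp⟩ hKA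
    rwa [← CFC.rpow_eq_cfc_real hA, CFC.rpow_rpow_of_exponent_nonneg A _ _ hp0.le (by positivity),
      mul_one_div_cancel hp0.ne', CFC.rpow_one A hA] at this
  rw [CFC.rpow_eq_cfc_real hK] at h1
  have h2 := ((ContinuousLinearMap.le_def _ _).1 h1).re_inner_nonneg_right e
  rw [sub_apply, cfc_apply_of_apply_eq_smul (IsSelfAdjoint.of_nonneg hK)
    (Real.continuous_rpow_const (by positivity))
    (Real.differentiableAt_rpow_const_of_ne _ hκ.ne') hKe,
    inner_sub_right, map_sub, inner_smul_right_eq_smul, RCLike.smul_re,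
    inner_self_eq_norm_sq, he] at h2
  linarith

/-- The partial trace of `A ^ p` over a finite orthonormal family is the trace of the finite rank operator
`K = A ^ (p / 2) P A ^ (p / 2) ≤ A ^ p`, where `P` projects onto the span of the family; the
eigenvectors of `K` serve as `e`. -/
theorem exists_orthonormal_rpow_le_inner {A : H →L[ℂ] H} (hA : 0 ≤ A) {p : ℝ} (hp : 1 ≤ p)
    {ι : Type*} [Fintype ι] {b : ι → H} (hb : Orthonormal ℂ b) :
    ∃ (J : Type) (_ : Fintype J) (e : J → H) (κ : J → ℝ), Orthonormal ℂ e ∧ (∀ i, 0 < κ i) ∧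
      ∑ i, κ i = ∑ i, RCLike.re ⟪b i, cfc (fun s : ℝ => s ^ p) A (b i)⟫_ℂ ∧
      ∀ i, κ i ^ (1 / p) ≤ RCLike.re ⟪e i, A (e i)⟫_ℂ := by
  set D := cfc (fun s : ℝ => s ^ p) A with hDdef
  have hD : 0 ≤ D :=
    cfc_nonneg fun s hs => Real.rpow_nonneg (spectrum_nonneg_of_nonneg hA hs) _
  obtain ⟨n, v, κ, hv, hvD, hsum⟩ := exists_orthonormal_diagonalizing
    (IsSelfAdjoint.of_nonneg hD) hb
  set S := CFC.sqrt D
  have hS0 : 0 ≤ S := CFC.sqrt_nonneg D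
  have hSS : S * S = D := CFC.sqrt_mul_sqrt_self D hD
  have hSsymm : ∀ x y, ⟪S x, y⟫_ℂ = ⟪x, S y⟫_ℂ :=
    ContinuousLinearMap.isSelfAdjoint_iff_isSymmetric.1 (IsSelfAdjoint.of_nonneg hS0)
  have hSD : ∀ x y, ⟪S x, S y⟫_ℂ = ⟪x, D y⟫_ℂ := fun x y => by
    rw [hSsymm, ← hSS, mul_apply_eq_comp]
  have hSv : ∀ i j, ⟪S (v i), S (v j)⟫_ℂ = if i = j then (κ j : ℂ) else 0 := fun i j => by
    rw [hSD, hvD]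
  have hκ : ∀ i, ‖S (v i)‖ ^ 2 = κ i := fun i => by
    have := hSv i i
    rw [if_pos rfl, inner_self_eq_norm_sq_to_K] at this
    exact Complex.ofReal_injective (by rw [← this]; simp)
  have hκ0 : ∀ i, 0 ≤ κ i := fun i => by rw [← hκ]; positivity
  -- `K = S P S`, where `P` projects onto the span of `v`; its eigenvectors are the `S (v k) ≠ 0`
  let K : H →L[ℂ] H := ∑ k, InnerProductSpace.rankOne ℂ (S (v k)) (S (v k))
  have hKapp : ∀ x, K x = ∑ k, ⟪S (v k), x⟫_ℂ • S (v k) := fun x => by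
    simp [K]
  have hKinner : ∀ x, ⟪x, K x⟫_ℂ = ((∑ k, ‖⟪v k, S x⟫_ℂ‖ ^ 2 : ℝ) : ℂ) := fun x => by
    rw [hKapp, inner_sum]
    push_cast
    refine Finset.sum_congr rfl fun k _ => ?_
    rw [inner_smul_right, ← inner_conj_symm x (S (v k)), hSsymm, Complex.mul_conj,
      Complex.normSq_eq_norm_sq]
    push_cast
    rfl
  have hK : 0 ≤ K := Finset.sum_nonneg fun k _ =>
    (ContinuousLinearMap.nonneg_iff_isPositive _).2 (InnerProductSpace.isPositive_rankOne_self _)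
  have hKD : K ≤ D := by
    rw [ContinuousLinearMap.le_def, ContinuousLinearMap.isPositive_def]
    refine ⟨ContinuousLinearMap.isSelfAdjoint_iff_isSymmetric.1
      ((IsSelfAdjoint.of_nonneg hD).sub (IsSelfAdjoint.of_nonneg hK)), fun x => ?_⟩
    rw [ContinuousLinearMap.reApplyInnerSelf_apply, inner_re_symm, sub_apply, inner_sub_right,
      map_sub, hKinner, ← hSD, inner_self_eq_norm_sq, RCLike.re_to_complex, Complex.ofReal_re,
      sub_nonneg]
    exact hv.sum_inner_products_le _
  let J := {i // 0 < κ i}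
  let e : J → H := fun i => (Real.sqrt (κ i))⁻¹ • S (v i)
  have hKe : ∀ i, K (e i) = κ i • e i := fun i => by
    simp only [e]
    rw [ContinuousLinearMap.map_smul_of_tower, hKapp, smul_comm]
    simp [hSv]
  have he : Orthonormal ℂ e := by
    classical
    refine orthonormal_iff_ite.2 fun i j => ?_
    simp only [e]
    rw [inner_smul_left_eq_smul, inner_smul_right_eq_smul, hSv]
    by_cases hij : i = j
    · subst hij
      rw [if_pos rfl, if_pos rfl, ← Complex.ofReal_one, Complex.real_smul, Complex.real_smul,
        ← Complex.ofReal_mul, ← Complex.ofReal_mul, ← mul_assoc, ← mul_inv,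
        Real.mul_self_sqrt (hκ0 i), inv_mul_cancel₀ i.2.ne']
    · rw [if_neg hij, if_neg (fun h => hij (Subtype.ext h))]
      simp
  refine ⟨J, inferInstance, e, fun i => κ i, he, fun i => i.2, ?_, fun i =>
    rpow_le_inner_of_le_cfc_rpow hA hp hK hKD i.2 (he.1 i) (hKe i)⟩
  classical
  rw [← hsum, ← Finset.sum_filter_of_ne (p := fun i => 0 < κ i)
    fun i _ hi => (hκ0 i).lt_of_ne' hi]
  exact (Finset.sum_subtype _ (by simp) κ).symm

/-- The lower bound in the variational description of `Tr |X| ^ p`, valid also for an infinite trace: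
sums of `p`-th powers of matrix entries `⟪V e, X e⟫`, with `e` orthonormal and `V` a contraction,
come arbitrarily close to it. -/
theorem exists_lt_sum_norm_inner_rpow (X : H →L[ℂ] H) {p : ℝ} (hp : 1 ≤ p) {c : ℝ≥0∞}
    (hc : c < posTrace (cfc (fun s : ℝ => s ^ p) (CFC.abs X))) :
    ∃ (J : Type) (_ : Fintype J) (e : J → H) (V : H →L[ℂ] H), Orthonormal ℂ e ∧ ‖V‖ ≤ 1 ∧
      (∀ i, ⟪V (e i), X (e i)⟫_ℂ ≠ 0) ∧
      c < ENNReal.ofReal (∑ i, ‖⟪V (e i), X (e i)⟫_ℂ‖ ^ p) := by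
  have hp0 : 0 < p := by linarith
  have hA := CFC.abs_nonneg X
  set A := CFC.abs X with hAdef
  have hD : 0 ≤ cfc (fun s : ℝ => s ^ p) A :=
    cfc_nonneg fun s hs => Real.rpow_nonneg (spectrum_nonneg_of_nonneg hA hs) _
  obtain ⟨b, hb⟩ := (exists_hilbertBasis ℂ H).choose_spec
  rw [posTrace_eq_tsum b ((ContinuousLinearMap.nonneg_iff_isPositive _).1 hD),
    ENNReal.tsum_eq_iSup_sum, lt_iSup_iff] at hc
  obtain ⟨s, hs⟩ := hc
  obtain ⟨J, hJ, e, κ, he, hκ, hsum, hle⟩ := exists_orthonormal_rpow_le_inner hA hp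
    (b.orthonormal.comp (fun i : s => (i : (exists_hilbertBasis ℂ H).choose))
      Subtype.val_injective)
  rw [← ENNReal.ofReal_sum_of_nonneg fun i _ =>
    ((ContinuousLinearMap.nonneg_iff_isPositive _).1 hD).re_inner_nonneg_right _,
    ← Finset.sum_coe_sort] at hs
  simp only [Function.comp_apply] at hsum
  rw [← hsum] at hs
  -- the approximate polar decompositions `U n` lose at most `1 / (n + 1)` on each vector
  choose U hU1 _ hU3 using fun n : ℕ =>
    exists_contraction_approx_polar X (Nat.one_div_pos_of_nat (α := ℝ) (n := n))
  have hbound : ∀ (n : ℕ) (i : J), κ i ^ (1 / p) - 1 / ((n : ℝ) + 1) ≤ ‖⟪U n (e i), X (e i)⟫_ℂ‖ := fun n i => by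
    have h1 : ⟪U n (e i), X (e i)⟫_ℂ = ⟪e i, A (e i)⟫_ℂ + ⟪e i, (star (U n) * X - A) (e i)⟫_ℂ := by
      rw [sub_apply, inner_sub_right, mul_apply_eq_comp, ContinuousLinearMap.star_eq_adjoint,
        ContinuousLinearMap.adjoint_inner_right]
      ring
    have h2 : ‖⟪e i, (star (U n) * X - A) (e i)⟫_ℂ‖ ≤ 1 / ((n : ℝ) + 1) := by
      refine (norm_inner_le_norm _ _).trans ?_
      rw [he.1 i, one_mul]
      refine (ContinuousLinearMap.le_opNorm _ _).trans ?_
      rw [he.1 i, mul_one]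
      exact hU3 n
    have h3 : κ i ^ (1 / p) ≤ ‖⟪e i, A (e i)⟫_ℂ‖ := (hle i).trans (RCLike.re_le_norm _)
    have h4 := norm_sub_le (⟪U n (e i), X (e i)⟫_ℂ) (⟪e i, (star (U n) * X - A) (e i)⟫_ℂ)
    rw [h1, add_sub_cancel_right, ← h1] at h4
    linarith
  have hlim : ∀ i, Filter.Tendsto (fun n : ℕ => κ i ^ (1 / p) - 1 / ((n : ℝ) + 1)) Filter.atTop
      (nhds (κ i ^ (1 / p))) := fun i => by
    simpa using tendsto_const_nhds.sub (tendsto_one_div_add_atTop_nhds_zero_nat (𝕜 := ℝ))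
  have hlim2 : Filter.Tendsto
      (fun n : ℕ => ENNReal.ofReal (∑ i, (κ i ^ (1 / p) - 1 / ((n : ℝ) + 1)) ^ p)) Filter.atTop
      (nhds (ENNReal.ofReal (∑ i, κ i))) := by
    refine (ENNReal.continuous_ofReal.tendsto _).comp (tendsto_finsetSum _ fun i _ => ?_)
    have := (hlim i).rpow_const (p := p) (Or.inr hp0.le)
    rwa [← Real.rpow_mul (hκ i).le, one_div_mul_cancel hp0.ne', Real.rpow_one] at this
  have hpos : ∀ᶠ n : ℕ in Filter.atTop, ∀ i, 0 < κ i ^ (1 / p) - 1 / ((n : ℝ) + 1) :=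
    Filter.eventually_all.2 fun i =>
      (hlim i).eventually_const_lt (Real.rpow_pos_of_pos (hκ i) _)
  obtain ⟨n, hn1, hn2⟩ := (hpos.and (hlim2.eventually_const_lt hs)).exists
  refine ⟨J, hJ, e, U n, he, hU1 n, fun i => ?_, hn2.trans_le ?_⟩
  · exact norm_pos_iff.1 ((hn1 i).trans_le (hbound n i))
  · refine ENNReal.ofReal_le_ofReal (Finset.sum_le_sum fun i _ => ?_)
    exact Real.rpow_le_rpow (hn1 i).le (hbound n i) hp0.le

/-! ### Holomorphy of complex powers -/

open scoped ComplexOrder in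
theorem mem_spectrum_complex_of_nonneg {C : H →L[ℂ] H} (hC : 0 ≤ C) {x : ℂ}
    (hx : x ∈ spectrum ℂ C) : 0 ≤ x.re ∧ x.re ≤ ‖C‖ ∧ x = (x.re : ℂ) := by
  have h0 := spectrum_nonneg_of_nonneg hC hx
  rw [Complex.le_def] at h0
  refine ⟨h0.1, (Complex.re_le_norm x).trans ?_, ?_⟩
  · exact (spectrum.norm_le_norm_mul_of_mem hx).trans
      (mul_le_of_le_one_right (norm_nonneg _) ContinuousLinearMap.norm_id_le)
  · exact Complex.ext (by simp) (by simpa using h0.2.symm)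

/-- Joint continuity of `(x, z) ↦ x ^ z` on `[0, ∞) × {Re z > 0}`, including the point `x = 0`. -/
theorem continuousAt_ofReal_cpow_of_nonneg {x : ℝ} (hx : 0 ≤ x) {z : ℂ} (hz : 0 < z.re) :
    ContinuousAt (fun p : ℂ × ℂ => p.1 ^ p.2) ((x : ℂ), z) := by
  rcases hx.eq_or_lt with rfl | hx
  · exact_mod_cast Complex.continuousAt_cpow_zero_of_re_pos hz
  · exact continuousAt_cpow (Or.inl (by simpa using hx))

theorem continuousOn_cpow_spectrum {C : H →L[ℂ] H} (hC : 0 ≤ C) {z : ℂ} (hz : 0 < z.re) :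
    ContinuousOn (fun x : ℂ => x ^ z) (spectrum ℂ C) := fun x hx => by
  obtain ⟨h0, -, hx⟩ := mem_spectrum_complex_of_nonneg hC hx
  have h := continuousAt_ofReal_cpow_of_nonneg h0 hz
  rw [← hx] at h
  exact (ContinuousAt.comp (f := fun y : ℂ => (y, z)) h (by fun_prop)).continuousWithinAt

theorem norm_opPow_le {C : H →L[ℂ] H} (hC : 0 ≤ C) {z : ℂ} (hz : 0 < z.re) :
    ‖opPow C z‖ ≤ ‖C‖ ^ z.re := by
  refine norm_cfc_le (by positivity) fun x hx => ?_
  obtain ⟨h0, h1, hx⟩ := mem_spectrum_complex_of_nonneg hC hx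
  rw [hx, Complex.norm_cpow_eq_rpow_re_of_nonneg h0 hz.ne']
  exact Real.rpow_le_rpow h0 h1 hz.le

/-- For `ε > 0` the function `z ↦ (C + ε) ^ z` is entire, being `exp (z log (C + ε))`. -/
theorem differentiable_cfc_add_cpow {C : H →L[ℂ] H} (hC : 0 ≤ C) {ε : ℝ} (hε : 0 < ε) :
    Differentiable ℂ fun z : ℂ => cfc (fun x : ℂ => (x + ε) ^ z) C := by
  have hN : IsStarNormal C := (IsSelfAdjoint.of_nonneg hC).isStarNormal
  have hslit : ∀ x ∈ spectrum ℂ C, x + ε ∈ Complex.slitPlane := fun x hx => by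
    obtain ⟨h0, -, hx⟩ := mem_spectrum_complex_of_nonneg hC hx
    exact Or.inl (by simp; linarith)
  have hlog : ContinuousOn (fun x : ℂ => Complex.log (x + ε)) (spectrum ℂ C) :=
    ContinuousOn.clog (by fun_prop) hslit
  have h : (fun z : ℂ => cfc (fun x : ℂ => (x + ε) ^ z) C) =
      fun z => NormedSpace.exp (z • cfc (fun x : ℂ => Complex.log (x + ε)) C) := by
    funext z
    rw [← cfc_const_mul z _ C hlog, ← CFC.complex_exp_eq_normedSpace_exp (cfc_predicate _ _),
      ← cfc_comp' Complex.exp (fun x : ℂ => z * Complex.log (x + ε)) C (by fun_prop)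
        (by fun_prop)]
    refine cfc_congr fun x hx => ?_
    rw [Complex.cpow_def_of_ne_zero (Complex.slitPlane_ne_zero (hslit x hx)), mul_comm]
  rw [h]
  exact fun z => (hasDerivAt_exp_smul_const _ z).differentiableAt

theorem tendstoLocallyUniformlyOn_cfc_add_cpow {C : H →L[ℂ] H} (hC : 0 ≤ C) :
    TendstoLocallyUniformlyOn
      (fun (n : ℕ) (z : ℂ) => cfc (fun x : ℂ => (x + ((1 / ((n : ℝ) + 1) : ℝ) : ℂ)) ^ z) C)
      (opPow C) Filter.atTop {z | 0 < z.re} := by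
  have hN : IsStarNormal C := (IsSelfAdjoint.of_nonneg hC).isStarNormal
  have hopen : IsOpen {z : ℂ | 0 < z.re} := isOpen_lt continuous_const Complex.continuous_re
  rw [tendstoLocallyUniformlyOn_iff_forall_isCompact hopen]
  intro K hKs hK
  rw [Metric.tendstoUniformlyOn_iff]
  intro δ hδ
  have hS : IsCompact (Set.Icc (0 : ℝ) 1 ×ˢ (K ×ˢ Set.Icc (0 : ℝ) ‖C‖)) :=
    isCompact_Icc.prod (hK.prod isCompact_Icc)
  have hcont : ContinuousOn (fun p : ℝ × ℂ × ℝ => ((p.2.2 + p.1 : ℝ) : ℂ) ^ p.2.1)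
      (Set.Icc (0 : ℝ) 1 ×ˢ (K ×ˢ Set.Icc (0 : ℝ) ‖C‖)) := by
    rintro ⟨t, z, x⟩ ⟨ht, hz, hx⟩
    have h := continuousAt_ofReal_cpow_of_nonneg (x := x + t) (add_nonneg hx.1 ht.1) (hKs hz)
    exact (ContinuousAt.comp (f := fun p : ℝ × ℂ × ℝ => (((p.2.2 + p.1 : ℝ) : ℂ), p.2.1))
      (x := (t, z, x)) h (by fun_prop)).continuousWithinAt
  obtain ⟨η, hη, hu⟩ := Metric.uniformContinuousOn_iff.1
    (hS.uniformContinuousOn_of_continuous hcont) (δ / 2) (half_pos hδ)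
  filter_upwards [(tendsto_one_div_add_atTop_nhds_zero_nat (𝕜 := ℝ)).eventually_lt_const hη]
    with n hn z hz
  have hε : 0 < 1 / ((n : ℝ) + 1) := by positivity
  have hε1 : 1 / ((n : ℝ) + 1) ≤ 1 := by
    rw [div_le_one (by positivity)]; linarith [n.cast_nonneg (α := ℝ)]
  have hc2 : ContinuousOn (fun x : ℂ => (x + ((1 / ((n : ℝ) + 1) : ℝ) : ℂ)) ^ z)
      (spectrum ℂ C) := fun x hx => by
    obtain ⟨h0, -, hx⟩ := mem_spectrum_complex_of_nonneg hC hx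
    have h := continuousAt_ofReal_cpow_of_nonneg (x := x.re + 1 / ((n : ℝ) + 1))
      (by positivity) (hKs hz)
    rw [Complex.ofReal_add, ← hx] at h
    exact (ContinuousAt.comp (f := fun y : ℂ => (y + ((1 / ((n : ℝ) + 1) : ℝ) : ℂ), z)) h
      (by fun_prop)).continuousWithinAt
  rw [opPow, dist_eq_norm, ← cfc_sub _ _ C (continuousOn_cpow_spectrum hC (hKs hz)) hc2]
  refine (norm_cfc_le (half_pos hδ).le fun x hx => ?_).trans_lt (half_lt_self hδ)
  obtain ⟨h0, h1, hx⟩ := mem_spectrum_complex_of_nonneg hC hx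
  have := hu (0, z, x.re) ⟨by simp, hz, h0, h1⟩ (1 / ((n : ℝ) + 1), z, x.re)
    ⟨⟨hε.le, hε1⟩, hz, h0, h1⟩ (by
      rw [Prod.dist_eq, dist_self, dist_zero_left, Real.norm_of_nonneg hε.le]
      exact max_lt hn hη)
  rw [dist_eq_norm] at this
  simp only [add_zero, Complex.ofReal_add, ← hx] at this
  exact this.le

/-- `z ↦ C ^ z` is holomorphic in norm on the open right half-plane, as the locally uniform limit of
`z ↦ (C + ε) ^ z`. On the imaginary axis norm continuity may fail, so nothing is said there. -/
theorem differentiableOn_opPow {C : H →L[ℂ] H} (hC : 0 ≤ C) :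
    DifferentiableOn ℂ (opPow C) {z | 0 < z.re} :=
  (tendstoLocallyUniformlyOn_cfc_add_cpow hC).differentiableOn
    (Filter.Eventually.of_forall fun n =>
      (differentiable_cfc_add_cpow hC (by positivity)).differentiableOn)
    (isOpen_lt continuous_const Complex.continuous_re)

theorem differentiableOn_chainPow {L : ℕ} {C : Fin L → H →L[ℂ] H} (hC : ∀ i, 0 ≤ C i) :
    DifferentiableOn ℂ (chainPow C) {z | 0 < z.re} := by
  induction L with
  | zero =>
    have : chainPow C = fun _ => 1 := by
      funext z
      simp [chainPow]
    rw [this]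
    exact differentiableOn_const 1
  | succ n ih =>
    have : chainPow C = fun z => opPow (C 0) z * chainPow (fun i => C i.succ) z := by
      funext z
      simp [chainPow, List.ofFn_succ]
    rw [this]
    exact (differentiableOn_opPow (hC 0)).mul (ih fun i => hC _)

theorem exists_norm_chainPow_le {L : ℕ} {C : Fin L → H →L[ℂ] H} (hC : ∀ i, 0 ≤ C i) :
    ∃ M : ℝ, 1 ≤ M ∧ ∀ z : ℂ, 0 < z.re → ‖chainPow C z‖ ≤ M ^ z.re := by
  induction L with
  | zero => exact ⟨1, le_rfl, fun z hz => by
      simp only [chainPow, List.ofFn_zero, List.prod_nil, Real.one_rpow]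
      exact ContinuousLinearMap.norm_id_le⟩
  | succ n ih =>
    obtain ⟨M, hM1, hM⟩ := ih (fun i => hC i.succ)
    refine ⟨max 1 ‖C 0‖ * M, one_le_mul_of_one_le_of_one_le (le_max_left _ _) hM1,
      fun z hz => ?_⟩
    have : chainPow C z = opPow (C 0) z * chainPow (fun i => C i.succ) z := by
      simp [chainPow, List.ofFn_succ]
    rw [this, Real.mul_rpow (by positivity) (by positivity)]
    refine (norm_mul_le _ _).trans ?_
    gcongr
    · exact (norm_opPow_le (hC 0) hz).trans
        (Real.rpow_le_rpow (norm_nonneg _) (le_max_right _ _) hz.le)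
    · exact hM z hz

end Operators

/-! ### The conformal map from the disk to the strip -/

/-- Subharmonicity of `log ‖f‖` on the unit disk, from Jensen's formula. The cut-off `η` keeps the
integrand bounded and continuous. -/
theorem log_norm_le_circleAverage_log_max {f : ℂ → ℂ} (hf : DifferentiableOn ℂ f (Metric.ball 0 1))
    (hf0 : f 0 ≠ 0) {r : ℝ} (hr0 : 0 < r) (hr1 : r < 1) {η : ℝ} (hη : 0 < η) :
    Real.log ‖f 0‖ ≤ Real.circleAverage (fun w => Real.log (max ‖f w‖ η)) 0 r := by
  have hsub : Metric.closedBall (0 : ℂ) |r| ⊆ Metric.ball 0 1 :=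
    Metric.closedBall_subset_ball (by rwa [abs_of_pos hr0])
  have han : AnalyticOnNhd ℂ f (Metric.closedBall 0 |r|) :=
    (hf.analyticOnNhd Metric.isOpen_ball).mono hsub
  have hJ := han.circleAverage_log_norm hr0.ne' hf0
  have hsum : 0 ≤ ∑ᶠ u, (MeromorphicOn.divisor f (Metric.closedBall 0 |r|) u : ℝ) *
      Real.log (r * ‖0 - u‖⁻¹) := by
    refine finsum_nonneg fun u => ?_
    by_cases hu : u ∈ Metric.closedBall (0 : ℂ) |r|
    · refine mul_nonneg (mod_cast MeromorphicOn.AnalyticOnNhd.divisor_nonneg han u) ?_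
      rcases eq_or_ne u 0 with rfl | hu0
      · simp
      · rw [zero_sub, norm_neg]
        have h1 : 0 < ‖u‖ := norm_pos_iff.2 hu0
        rw [mem_closedBall_zero_iff, abs_of_pos hr0] at hu
        refine Real.log_nonneg ?_
        rw [← div_eq_mul_inv, one_le_div h1]
        exact hu
    · simp [hu]
  classical
  -- `Real.log 0 = 0`, so the values at the finitely many zeros on the circle are changed first
  let F : ℂ → ℝ := fun w => if f w = 0 then Real.log η else Real.log ‖f w‖
  have hFcod : (fun w => Real.log ‖f w‖) =ᶠ[Filter.codiscreteWithin (Metric.sphere 0 |r|)] F := by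
    have h1 := han.preimage_zero_mem_codiscreteWithin (x := 0) hf0 (by simp)
      ⟨Metric.nonempty_closedBall.2 (abs_nonneg r), (convex_closedBall _ _).isPreconnected⟩
    have h2 := Filter.codiscreteWithin_mono
      (Metric.sphere_subset_closedBall (x := (0 : ℂ)) (ε := |r|)) h1
    filter_upwards [h2] with w hw
    have : f w ≠ 0 := by simpa using hw
    simp [F, this]
  have hint : CircleIntegrable (fun w => Real.log ‖f w‖) 0 r :=
    (han.mono Metric.sphere_subset_closedBall).meromorphicOn.circleIntegrable_log_norm
  have hle : Real.circleAverage F 0 r ≤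
      Real.circleAverage (fun w => Real.log (max ‖f w‖ η)) 0 r := by
    refine Real.circleAverage_mono (hint.congr_codiscreteWithin hFcod) ?_ fun w _ => ?_
    · refine ContinuousOn.circleIntegrable' ?_
      refine ContinuousOn.log ?_ fun w _ => (hη.trans_le (le_max_right _ _)).ne'
      exact ((han.continuousOn.mono Metric.sphere_subset_closedBall).norm).sup continuousOn_const
    · by_cases hw : f w = 0
      · simp [F, hw, hη.le]
      · simp only [F, hw, if_false]
        exact Real.log_le_log (norm_pos_iff.2 hw) (le_max_left _ _)
  rw [Real.circleAverage_congr_codiscreteWithin hFcod hr0.ne'] at hJ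
  linarith

/-- The Möbius map from the unit disk onto the upper half-plane that sends `0` to `exp (iα)` and `1` to
the point at infinity. -/
noncomputable def diskToHalfPlane (α : ℝ) (w : ℂ) : ℂ :=
  Real.cos α + Complex.I * Real.sin α * ((1 + w) / (1 - w))

/-- The conformal map from the unit disk onto the strip `0 < Re z < 1` that sends `0` to `α / π`. -/
noncomputable def diskToStrip (α : ℝ) (w : ℂ) : ℂ :=
  -Complex.I / Real.pi * Complex.log (diskToHalfPlane α w)

theorem im_diskToHalfPlane_pos {α : ℝ} (hα : 0 < Real.sin α) {w : ℂ} (hw : ‖w‖ < 1) :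
    0 < (diskToHalfPlane α w).im := by
  have hne : 1 - w ≠ 0 := fun h => by
    rw [sub_eq_zero] at h
    simp [← h] at hw
  have hre : 0 < ((1 + w) / (1 - w)).re := by
    have h1 : ((1 + w) / (1 - w)).re = (1 - ‖w‖ ^ 2) / Complex.normSq (1 - w) := by
      rw [Complex.div_re, ← Complex.normSq_eq_norm_sq, Complex.normSq_apply w]
      simp only [Complex.add_re, Complex.sub_re, Complex.add_im, Complex.sub_im, Complex.one_re,
        Complex.one_im]
      ring
    rw [h1]
    have := Complex.normSq_pos.2 hne
    have : ‖w‖ ^ 2 < 1 := by nlinarith [norm_nonneg w]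
    apply div_pos <;> linarith
  have : (diskToHalfPlane α w).im = Real.sin α * ((1 + w) / (1 - w)).re := by
    rw [diskToHalfPlane, mul_assoc]
    simp [-Complex.ofReal_sin, -Complex.ofReal_cos]
  rw [this]
  positivity

theorem continuousAt_diskToHalfPlane (α : ℝ) {w : ℂ} (hw : w ≠ 1) :
    ContinuousAt (diskToHalfPlane α) w := by
  unfold diskToHalfPlane
  have : 1 - w ≠ 0 := sub_ne_zero.2 hw.symm
  fun_prop (disch := assumption)

theorem differentiableOn_diskToStrip {α : ℝ} (hα : 0 < Real.sin α) :
    DifferentiableOn ℂ (diskToStrip α) (Metric.ball 0 1) := by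
  intro w hw
  rw [mem_ball_zero_iff] at hw
  have hne : 1 - w ≠ 0 := fun h => by
    rw [sub_eq_zero] at h
    simp [← h] at hw
  have h1 : DifferentiableAt ℂ (diskToHalfPlane α) w := by
    unfold diskToHalfPlane
    fun_prop (disch := assumption)
  exact ((h1.clog (Or.inr (im_diskToHalfPlane_pos hα hw).ne')).const_mul _).differentiableWithinAt

theorem re_diskToStrip (α : ℝ) (w : ℂ) :
    (diskToStrip α w).re = Complex.arg (diskToHalfPlane α w) / Real.pi := by
  rw [diskToStrip, div_mul_eq_mul_div, Complex.div_ofReal_re]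
  simp [Complex.log_im]

theorem re_diskToStrip_mem {α : ℝ} (hα : 0 < Real.sin α) {w : ℂ} (hw : ‖w‖ < 1) :
    0 < (diskToStrip α w).re ∧ (diskToStrip α w).re < 1 := by
  have h := im_diskToHalfPlane_pos hα hw
  rw [re_diskToStrip, div_lt_one Real.pi_pos]
  refine ⟨div_pos ?_ Real.pi_pos, ?_⟩
  · refine (Complex.arg_nonneg_iff.2 h.le).lt_of_ne' fun h0 => h.ne' ?_
    exact (Complex.arg_eq_zero_iff.1 h0).2
  · refine (Complex.arg_le_pi _).lt_of_ne fun h0 => h.ne' ?_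
    exact (Complex.arg_eq_pi_iff.1 h0).2

theorem diskToStrip_zero {θ : ℝ} (h0 : 0 < θ) (h1 : θ < 1) :
    diskToStrip (Real.pi * θ) 0 = θ := by
  have hπ := Real.pi_pos
  have h : diskToHalfPlane (Real.pi * θ) 0 = Complex.exp ((Real.pi * θ : ℝ) * Complex.I) := by
    rw [diskToHalfPlane, Complex.exp_mul_I]
    push_cast
    ring
  rw [diskToStrip, h, Complex.log_exp]
  · have : (Real.pi : ℂ) ≠ 0 := by exact_mod_cast hπ.ne'
    push_cast
    field_simp
    simp
  · simp only [Complex.mul_im, Complex.ofReal_re, Complex.I_im, Complex.ofReal_im, Complex.I_re]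
    nlinarith
  · simp only [Complex.mul_im, Complex.ofReal_re, Complex.I_im, Complex.ofReal_im, Complex.I_re]
    nlinarith

theorem exp_pi_sub_two_arctan (y : ℝ) :
    Complex.exp ((Real.pi - 2 * Real.arctan y : ℝ) * Complex.I) =
      -((1 - Complex.I * y) / (1 + Complex.I * y)) := by
  have hs : Real.cos (Real.arctan y) ≠ 0 := (Real.cos_arctan_pos y).ne'
  have hy : Real.sin (Real.arctan y) = y * Real.cos (Real.arctan y) := by
    rw [← div_eq_iff hs, ← Real.tan_eq_sin_div_cos, Real.tan_arctan]
  have h1 : (1 + Complex.I * y) ≠ 0 := fun h => by simpa using congrArg Complex.re h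
  have hc : (Real.cos (Real.arctan y) : ℂ) ≠ 0 := by exact_mod_cast hs
  have e1 : Complex.exp ((Real.arctan y : ℝ) * Complex.I) =
      Real.cos (Real.arctan y) * (1 + Complex.I * y) := by
    rw [Complex.exp_mul_I, ← Complex.ofReal_cos, ← Complex.ofReal_sin, hy]
    push_cast
    ring
  have e2 : Complex.exp (-((Real.arctan y : ℝ) * Complex.I)) =
      Real.cos (Real.arctan y) * (1 - Complex.I * y) := by
    rw [← neg_mul, Complex.exp_mul_I, Complex.cos_neg, Complex.sin_neg, ← Complex.ofReal_cos,
      ← Complex.ofReal_sin, hy]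
    push_cast
    ring
  have e3 : ((Real.pi - 2 * Real.arctan y : ℝ) * Complex.I : ℂ) = Real.pi * Complex.I +
      -((Real.arctan y : ℝ) * Complex.I) - (Real.arctan y : ℝ) * Complex.I := by
    push_cast
    ring
  rw [e3, Complex.exp_sub, Complex.exp_add, e1, e2, Complex.exp_pi_mul_I]
  field_simp

/-- Every point `≠ 1` of the unit circle is `exp (i (π - 2 arctan y))` for some real `y`, and the map is
affine in `y`. -/
theorem diskToHalfPlane_exp (α y : ℝ) :
    diskToHalfPlane α (Complex.exp ((Real.pi - 2 * Real.arctan y : ℝ) * Complex.I)) =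
      ((Real.cos α - Real.sin α * y : ℝ) : ℂ) := by
  have h1 : (1 + Complex.I * y) ≠ 0 := fun h => by simpa using congrArg Complex.re h
  rw [exp_pi_sub_two_arctan, diskToHalfPlane]
  have h2 : (1 + -((1 - Complex.I * y) / (1 + Complex.I * y))) /
      (1 - -((1 - Complex.I * y) / (1 + Complex.I * y))) = Complex.I * y := by
    have : (1 - -((1 - Complex.I * y) / (1 + Complex.I * y))) = 2 / (1 + Complex.I * y) := by
      field_simp
      ring
    rw [this]
    field_simp
    ring
  rw [h2]
  push_cast
  linear_combination (Complex.sin α * y) * Complex.I_sq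

theorem exp_mul_I_ne_one {φ : ℝ} (h0 : 0 < φ) (h1 : φ < 2 * Real.pi) :
    Complex.exp (φ * Complex.I) ≠ 1 := by
  intro h
  obtain ⟨n, hn⟩ := Complex.exp_eq_one_iff.1 h
  have h2 : φ = n * (2 * Real.pi) := by
    have := congrArg Complex.im hn
    simpa using this
  have hπ := Real.pi_pos
  have h3 : (0 : ℝ) < n := by
    by_contra! hn
    nlinarith
  have h4 : (n : ℝ) < 1 := by
    by_contra! hn
    nlinarith
  norm_cast at h3 h4
  omega

/-- The radial limits, taken within the closed upper half-plane, where `log` is continuous even at the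
negative reals. -/
theorem tendsto_diskToHalfPlane_radial {α : ℝ} (hα : 0 < Real.sin α) {φ : ℝ} (h0 : 0 < φ)
    (h1 : φ < 2 * Real.pi) :
    Filter.Tendsto (fun r : ℝ => diskToHalfPlane α (circleMap 0 r φ)) (nhdsWithin 1 (Set.Iio 1))
      (nhdsWithin (diskToHalfPlane α (Complex.exp (φ * Complex.I))) {z | 0 ≤ z.im}) := by
  refine tendsto_nhdsWithin_iff.2 ⟨?_, ?_⟩
  · have h2 : Filter.Tendsto (fun r : ℝ => circleMap 0 r φ) (nhdsWithin 1 (Set.Iio 1))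
        (nhds (Complex.exp (φ * Complex.I))) := by
      have : Continuous fun r : ℝ => circleMap 0 r φ := by unfold circleMap; fun_prop
      simpa [circleMap] using (this.tendsto 1).mono_left nhdsWithin_le_nhds
    exact (continuousAt_diskToHalfPlane α (exp_mul_I_ne_one h0 h1)).tendsto.comp h2
  · filter_upwards [Ioo_mem_nhdsLT (zero_lt_one' ℝ)] with r hr
    refine (im_diskToHalfPlane_pos hα ?_).le
    rw [norm_circleMap_zero, abs_of_pos hr.1]
    exact hr.2

/-! ### Harmonic measure of the strip -/

/-- The argument in `(0, 2α)` of the point of the unit circle that `diskToStrip α` sends to the boundary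
point `1 + it` of the strip. -/
noncomputable def boundaryAngle (α t : ℝ) : ℝ :=
  Real.pi - 2 * Real.arctan ((Real.cos α + Real.exp (-(Real.pi * t))) / Real.sin α)

theorem two_arctan_cos_div_sin {α : ℝ} (h0 : 0 < α) (h1 : α < Real.pi) :
    2 * Real.arctan (Real.cos α / Real.sin α) = Real.pi - 2 * α := by
  have : Real.cos α / Real.sin α = Real.tan (Real.pi / 2 - α) := by
    rw [Real.tan_pi_div_two_sub, Real.tan_eq_sin_div_cos, inv_div]
  rw [this, Real.arctan_tan (by linarith) (by linarith)]
  ring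

theorem sin_pi_mul_pos {θ : ℝ} (h0 : 0 < θ) (h1 : θ < 1) : 0 < Real.sin (Real.pi * θ) :=
  Real.sin_pos_of_pos_of_lt_pi (by have := Real.pi_pos; positivity)
    (by nlinarith [Real.pi_pos])

theorem cosh_add_cos_pos {θ : ℝ} (h0 : 0 < θ) (h1 : θ < 1) (t : ℝ) :
    0 < Real.cosh (Real.pi * t) + Real.cos (Real.pi * θ) := by
  have hs := sin_pi_mul_pos h0 h1
  have h2 : -1 < Real.cos (Real.pi * θ) := by
    have := Real.sin_sq_add_cos_sq (Real.pi * θ)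
    nlinarith
  linarith [Real.one_le_cosh (Real.pi * t)]

theorem betaDensity_nonneg {θ : ℝ} (h0 : 0 < θ) (h1 : θ < 1) (t : ℝ) : 0 ≤ betaDensity θ t := by
  have := cosh_add_cos_pos h0 h1 t
  have := sin_pi_mul_pos h0 h1
  unfold betaDensity
  positivity

/-- The harmonic measure of the line `Re z = 1`, seen from `θ`, is `θ` times `betaDensity θ`. -/
theorem hasDerivAt_boundaryAngle {θ : ℝ} (h0 : 0 < θ) (h1 : θ < 1) (t : ℝ) :
    HasDerivAt (boundaryAngle (Real.pi * θ)) (2 * Real.pi * θ * betaDensity θ t) t := by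
  have hs := sin_pi_mul_pos h0 h1
  set s := Real.sin (Real.pi * θ) with hs'
  set c := Real.cos (Real.pi * θ) with hc'
  have hsc : s ^ 2 + c ^ 2 = 1 := Real.sin_sq_add_cos_sq _
  have he : HasDerivAt (fun t : ℝ => Real.exp (-(Real.pi * t)))
      (Real.exp (-(Real.pi * t)) * -Real.pi) t := by
    simpa using ((hasDerivAt_id t).const_mul Real.pi).neg.exp
  have h := ((((he.const_add c).div_const s).arctan).const_mul 2).const_sub Real.pi
  refine h.congr_deriv ?_
  have hb : betaDensity θ t = s / (2 * θ * (Real.cosh (Real.pi * t) + c)) := rfl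
  have hcosh := cosh_add_cos_pos h0 h1 t
  rw [Real.cosh_eq] at hcosh
  rw [hb, Real.cosh_eq]
  have hE : Real.exp (Real.pi * t) = (Real.exp (-(Real.pi * t)))⁻¹ := by
    rw [Real.exp_neg, inv_inv]
  have hEpos : 0 < Real.exp (-(Real.pi * t)) := Real.exp_pos _
  rw [hE] at hcosh ⊢
  set E := Real.exp (-(Real.pi * t))
  have hden : 0 < 1 + E ^ 2 + 2 * c * E := by
    have : 1 + E ^ 2 + 2 * c * E = 2 * E * ((E⁻¹ + E) / 2 + c) := by
      field_simp
    rw [this]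
    positivity
  have e1 : (E⁻¹ + E) / 2 + c = (1 + E ^ 2 + 2 * c * E) / (2 * E) := by
    field_simp
  have e2 : 1 + ((c + E) / s) ^ 2 = (1 + E ^ 2 + 2 * c * E) / s ^ 2 := by
    field_simp
    linear_combination hsc
  rw [e1, e2]
  field_simp

theorem range_boundaryAngle {α : ℝ} (h0 : 0 < α) (h1 : α < Real.pi) :
    Set.range (boundaryAngle α) = Set.Ioo 0 (2 * α) := by
  have hs : 0 < Real.sin α := Real.sin_pos_of_pos_of_lt_pi h0 h1
  have hcot := two_arctan_cos_div_sin h0 h1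
  ext φ
  constructor
  · rintro ⟨t, rfl⟩
    have h2 : Real.cos α / Real.sin α < (Real.cos α + Real.exp (-(Real.pi * t))) / Real.sin α := by
      gcongr
      linarith [Real.exp_pos (-(Real.pi * t))]
    have h3 := Real.arctan_strictMono h2
    have h4 := Real.arctan_lt_pi_div_two ((Real.cos α + Real.exp (-(Real.pi * t))) / Real.sin α)
    constructor <;> unfold boundaryAngle <;> linarith
  · rintro ⟨hφ0, hφ1⟩
    have hat : Real.arctan (Real.tan ((Real.pi - φ) / 2)) = (Real.pi - φ) / 2 :=
      Real.arctan_tan (by linarith) (by linarith)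
    have h2 : Real.cos α / Real.sin α < Real.tan ((Real.pi - φ) / 2) := by
      refine Real.arctan_strictMono.lt_iff_lt.1 ?_
      rw [hat]
      linarith
    rw [div_lt_iff₀ hs] at h2
    refine ⟨-(Real.log (Real.tan ((Real.pi - φ) / 2) * Real.sin α - Real.cos α) / Real.pi), ?_⟩
    have hπ := Real.pi_pos.ne'
    have h3 : -(Real.pi * -(Real.log (Real.tan ((Real.pi - φ) / 2) * Real.sin α - Real.cos α) /
        Real.pi)) = Real.log (Real.tan ((Real.pi - φ) / 2) * Real.sin α - Real.cos α) := by
      field_simp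
    rw [boundaryAngle, h3, Real.exp_log (by linarith), add_sub_cancel,
      mul_div_cancel_right₀ _ hs.ne', hat]
    ring

theorem boundaryAngle_injective {α : ℝ} (hs : 0 < Real.sin α) :
    Function.Injective (boundaryAngle α) := by
  intro t u h
  unfold boundaryAngle at h
  have h1 := Real.arctan_injective (mul_left_cancel₀ two_ne_zero (sub_right_injective h))
  rw [div_left_inj' hs.ne', add_right_inj, Real.exp_eq_exp, neg_inj] at h1
  exact mul_left_cancel₀ Real.pi_pos.ne' h1

theorem tendsto_diskToStrip_right {α : ℝ} (h0 : 0 < α) (h1 : α < Real.pi) (t : ℝ) :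
    Filter.Tendsto (fun r : ℝ => diskToStrip α (circleMap 0 r (boundaryAngle α t)))
      (nhdsWithin 1 (Set.Iio 1)) (nhds (1 + t * Complex.I)) := by
  have hs : 0 < Real.sin α := Real.sin_pos_of_pos_of_lt_pi h0 h1
  have hmem : boundaryAngle α t ∈ Set.Ioo 0 (2 * α) := range_boundaryAngle h0 h1 ▸ ⟨t, rfl⟩
  have h := tendsto_diskToHalfPlane_radial hs hmem.1 (by linarith [hmem.2])
  have hval : diskToHalfPlane α (Complex.exp (boundaryAngle α t * Complex.I)) =
      ((-Real.exp (-(Real.pi * t)) : ℝ) : ℂ) := by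
    rw [boundaryAngle, diskToHalfPlane_exp, mul_div_cancel₀ _ hs.ne']
    push_cast
    ring
  rw [hval] at h
  have hpos := Real.exp_pos (-(Real.pi * t))
  have hl := ((Complex.continuousWithinAt_log_of_re_neg_of_im_zero
    (z := ((-Real.exp (-(Real.pi * t)) : ℝ) : ℂ)) (by rw [Complex.ofReal_re]; linarith)
    (Complex.ofReal_im _)).tendsto.comp
    h).const_mul (-Complex.I / Real.pi)
  have hπ : (Real.pi : ℂ) ≠ 0 := by exact_mod_cast Real.pi_pos.ne'
  have hlog : Complex.log ((-Real.exp (-(Real.pi * t)) : ℝ) : ℂ) =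
      -(Real.pi * t) + Real.pi * Complex.I := by
    rw [Complex.log, Complex.arg_ofReal_of_neg (by linarith), Complex.norm_real, norm_neg,
      Real.norm_of_nonneg hpos.le, Real.log_exp]
    push_cast
    ring
  rw [hlog] at hl
  have hlim : (1 + t * Complex.I : ℂ) =
      -Complex.I / Real.pi * (-(Real.pi * t) + Real.pi * Complex.I) := by
    field_simp
    linear_combination Complex.I_sq
  rw [hlim]
  exact hl

theorem tendsto_re_diskToStrip_left {α : ℝ} (h0 : 0 < α) (h1 : α < Real.pi) {φ : ℝ}
    (hφ0 : 2 * α < φ) (hφ1 : φ < 2 * Real.pi) :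
    Filter.Tendsto (fun r : ℝ => (diskToStrip α (circleMap 0 r φ)).re)
      (nhdsWithin 1 (Set.Iio 1)) (nhds 0) := by
  have hs : 0 < Real.sin α := Real.sin_pos_of_pos_of_lt_pi h0 h1
  have h := (tendsto_diskToHalfPlane_radial hs (by linarith) hφ1).mono_right nhdsWithin_le_nhds
  have hat : Real.arctan (Real.tan ((Real.pi - φ) / 2)) = (Real.pi - φ) / 2 :=
    Real.arctan_tan (by linarith) (by linarith)
  set y := Real.tan ((Real.pi - φ) / 2) with hy
  have hφ : φ = Real.pi - 2 * Real.arctan y := by rw [hat]; ring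
  have hlt : y < Real.cos α / Real.sin α := by
    refine Real.arctan_strictMono.lt_iff_lt.1 ?_
    have hcot := two_arctan_cos_div_sin h0 h1
    rw [hat]
    linarith
  rw [lt_div_iff₀ hs] at hlt
  have hpos : 0 < Real.cos α - Real.sin α * y := by linarith
  have hval : diskToHalfPlane α (Complex.exp (φ * Complex.I)) =
      ((Real.cos α - Real.sin α * y : ℝ) : ℂ) := by
    rw [hφ, diskToHalfPlane_exp]
  rw [hval] at h
  have ha := ((Complex.continuousAt_arg (x := ((Real.cos α - Real.sin α * y : ℝ) : ℂ))
    (Complex.ofReal_mem_slitPlane.2 hpos)).tendsto.comp h).div_const Real.pi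
  rw [Complex.arg_ofReal_of_nonneg hpos.le, zero_div] at ha
  exact ha.congr fun r => (re_diskToStrip α _).symm

theorem integrableOn_comp_boundaryAngle_iff {θ : ℝ} (h0 : 0 < θ) (h1 : θ < 1) (u : ℝ → ℝ) :
    IntegrableOn u (Set.Ioo 0 (2 * (Real.pi * θ))) ↔
      Integrable fun t => 2 * Real.pi * θ * betaDensity θ t * u (boundaryAngle (Real.pi * θ) t) := by
  have hα1 : Real.pi * θ < Real.pi := by nlinarith [Real.pi_pos]
  have hα0 : 0 < Real.pi * θ := mul_pos Real.pi_pos h0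
  have h := integrableOn_image_iff_integrableOn_abs_deriv_smul MeasurableSet.univ
    (fun t _ => (hasDerivAt_boundaryAngle h0 h1 t).hasDerivWithinAt)
    ((boundaryAngle_injective (sin_pi_mul_pos h0 h1)).injOn) u
  rw [Set.image_univ, range_boundaryAngle hα0 hα1, integrableOn_univ] at h
  rw [h]
  refine integrable_congr (Filter.Eventually.of_forall fun t => ?_)
  have := betaDensity_nonneg h0 h1 t
  have hπ := Real.pi_pos
  simp only [smul_eq_mul]
  rw [abs_of_nonneg (by positivity)]

theorem integral_Ioo_eq_integral_betaDensity {θ : ℝ} (h0 : 0 < θ) (h1 : θ < 1) (u : ℝ → ℝ) :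
    ∫ φ in Set.Ioo 0 (2 * (Real.pi * θ)), u φ =
      ∫ t, 2 * Real.pi * θ * betaDensity θ t * u (boundaryAngle (Real.pi * θ) t) := by
  have hα1 : Real.pi * θ < Real.pi := by nlinarith [Real.pi_pos]
  have hα0 : 0 < Real.pi * θ := mul_pos Real.pi_pos h0
  have h := integral_image_eq_integral_abs_deriv_smul MeasurableSet.univ
    (fun t _ => (hasDerivAt_boundaryAngle h0 h1 t).hasDerivWithinAt)
    ((boundaryAngle_injective (sin_pi_mul_pos h0 h1)).injOn) u
  rw [Set.image_univ, range_boundaryAngle hα0 hα1, setIntegral_univ] at h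
  rw [h]
  refine integral_congr_ae (Filter.Eventually.of_forall fun t => ?_)
  have := betaDensity_nonneg h0 h1 t
  have hπ := Real.pi_pos
  simp only [smul_eq_mul]
  rw [abs_of_nonneg (by positivity)]

theorem integrable_betaDensity {θ : ℝ} (h0 : 0 < θ) (h1 : θ < 1) :
    Integrable (betaDensity θ) := by
  have h := (integrableOn_comp_boundaryAngle_iff h0 h1 (fun _ => 1)).1
    (integrableOn_const measure_Ioo_lt_top.ne)
  have hπ := Real.pi_pos
  have h2 := h.const_mul (2 * Real.pi * θ)⁻¹
  refine h2.congr (Filter.Eventually.of_forall fun t => ?_)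
  simp only
  field_simp

theorem integral_betaDensity {θ : ℝ} (h0 : 0 < θ) (h1 : θ < 1) : ∫ t, betaDensity θ t = 1 := by
  have h := integral_Ioo_eq_integral_betaDensity h0 h1 (fun _ => 1)
  have hπ := Real.pi_pos
  simp only [mul_one, integral_const_mul] at h
  rw [setIntegral_const, measureReal_def, Real.volume_Ioo, sub_zero,
    ENNReal.toReal_ofReal (by positivity), smul_eq_mul, mul_one] at h
  have h2 : 2 * Real.pi * θ * ∫ t, betaDensity θ t = 2 * Real.pi * θ * 1 := by linarith
  exact mul_left_cancel₀ (by positivity) h2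

theorem continuous_betaDensity {θ : ℝ} (h0 : 0 < θ) (h1 : θ < 1) : Continuous (betaDensity θ) := by
  unfold betaDensity
  refine Continuous.div continuous_const (by fun_prop) fun t => ?_
  have := cosh_add_cos_pos h0 h1 t
  positivity

/-! ### Hirschman's lemma -/

theorem abs_log_max_le {y B η : ℝ} (hη : 0 < η) (hy : y ≤ B) :
    |Real.log (max y η)| ≤ max |Real.log η| |Real.log (max B η)| := by
  refine abs_le_max_abs_abs (Real.log_le_log hη (le_max_right _ _)) ?_
  exact Real.log_le_log (hη.trans_le (le_max_right _ _)) (max_le_max_right _ hy)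

theorem continuous_log_max {X : Type*} [TopologicalSpace X] {u : X → ℝ} (hu : Continuous u) {η : ℝ}
    (hη : 0 < η) : Continuous fun x => Real.log (max (u x) η) :=
  (hu.max continuous_const).log fun _ => (hη.trans_le (le_max_right _ _)).ne'

/-- Hirschman's refinement of the three lines lemma, with cut-off `η`: on the line `Re z = 1` the bound is
the actual value of `g`, while towards the line `Re z = 0` only the majorant `c` is used, so that `g`
need not extend there. -/
theorem log_norm_le_integral_betaDensity {θ : ℝ} (h0 : 0 < θ) (h1 : θ < 1) {g : ℂ → ℂ}
    (hg : DifferentiableOn ℂ g {z | 0 < z.re}) {c : ℝ → ℝ} (hc : Continuous c)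
    (hgc : ∀ z : ℂ, 0 < z.re → z.re < 1 → ‖g z‖ ≤ c z.re) (hgθ : g θ ≠ 0) {η : ℝ} (hη : 0 < η) :
    Real.log ‖g θ‖ ≤ (1 - θ) * Real.log (max (c 0) η) +
      θ * ∫ t : ℝ, betaDensity θ t * Real.log (max ‖g (1 + t * Complex.I)‖ η) := by
  have hπ := Real.pi_pos
  set α := Real.pi * θ with hα
  have hα0 : 0 < α := mul_pos hπ h0
  have hα1 : α < Real.pi := by nlinarith
  have hs : 0 < Real.sin α := sin_pi_mul_pos h0 h1
  have hopen : IsOpen {z : ℂ | 0 < z.re} := isOpen_lt continuous_const Complex.continuous_re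
  obtain ⟨B, hB⟩ := (isCompact_Icc (a := (0 : ℝ)) (b := 1)).exists_bound_of_continuousOn
    hc.continuousOn
  have hcB : ∀ w : ℂ, ‖w‖ < 1 → c (diskToStrip α w).re ≤ B := fun w hw => by
    have hm := re_diskToStrip_mem hs hw
    exact (le_abs_self _).trans (hB _ ⟨hm.1.le, hm.2.le⟩)
  have hgcw : ∀ w : ℂ, ‖w‖ < 1 → ‖g (diskToStrip α w)‖ ≤ c (diskToStrip α w).re := fun w hw =>
    hgc _ (re_diskToStrip_mem hs hw).1 (re_diskToStrip_mem hs hw).2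
  set K := max |Real.log η| |Real.log (max B η)| with hK
  have hψ := differentiableOn_diskToStrip hs
  have hf : DifferentiableOn ℂ (fun w => g (diskToStrip α w)) (Metric.ball 0 1) :=
    hg.comp hψ fun w hw => (re_diskToStrip_mem hs (mem_ball_zero_iff.1 hw)).1
  have hψ0 : diskToStrip α 0 = θ := diskToStrip_zero h0 h1
  have hnorm : ∀ r ∈ Set.Ioo (0 : ℝ) 1, ∀ φ, ‖circleMap 0 r φ‖ < 1 := fun r hr φ => by
    rw [norm_circleMap_zero, abs_of_pos hr.1]
    exact hr.2
  have hcircle : ∀ r ∈ Set.Ioo (0 : ℝ) 1, Continuous fun φ => diskToStrip α (circleMap 0 r φ) :=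
    fun r hr => hψ.continuousOn.comp_continuous (continuous_circleMap 0 r)
      fun φ => mem_ball_zero_iff.2 (hnorm r hr φ)
  -- the integrand on the circle of radius `r`, and its majorant on the left arc
  let u : ℝ → ℝ → ℝ := fun r φ => Real.log (max ‖g (diskToStrip α (circleMap 0 r φ))‖ η)
  let v : ℝ → ℝ → ℝ := fun r φ => Real.log (max (c (diskToStrip α (circleMap 0 r φ)).re) η)
  have hu : ∀ r ∈ Set.Ioo (0 : ℝ) 1, Continuous (u r) := fun r hr =>
    continuous_log_max (hf.continuousOn.comp_continuous (continuous_circleMap 0 r)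
      fun φ => mem_ball_zero_iff.2 (hnorm r hr φ)).norm hη
  have hv : ∀ r ∈ Set.Ioo (0 : ℝ) 1, Continuous (v r) := fun r hr =>
    continuous_log_max (hc.comp (Complex.continuous_re.comp (hcircle r hr))) hη
  have huK : ∀ r ∈ Set.Ioo (0 : ℝ) 1, ∀ φ, |u r φ| ≤ K := fun r hr φ =>
    abs_log_max_le hη ((hgcw _ (hnorm r hr φ)).trans (hcB _ (hnorm r hr φ)))
  have hvK : ∀ r ∈ Set.Ioo (0 : ℝ) 1, ∀ φ, |v r φ| ≤ K := fun r hr φ =>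
    abs_log_max_le hη (hcB _ (hnorm r hr φ))
  have huv : ∀ r ∈ Set.Ioo (0 : ℝ) 1, ∀ φ, u r φ ≤ v r φ := fun r hr φ =>
    Real.log_le_log (hη.trans_le (le_max_right _ _)) (max_le_max_right _ (hgcw _ (hnorm r hr φ)))
  have hnear : Set.Ioo (0 : ℝ) 1 ∈ nhdsWithin (1 : ℝ) (Set.Iio 1) :=
    Ioo_mem_nhdsLT (zero_lt_one' ℝ)
  have hineq : ∀ r ∈ Set.Ioo (0 : ℝ) 1, Real.log ‖g θ‖ ≤ (2 * Real.pi)⁻¹ *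
      ((∫ t, 2 * Real.pi * θ * betaDensity θ t * u r (boundaryAngle α t)) +
        ∫ φ in Set.Ioo (2 * α) (2 * Real.pi), v r φ) := fun r hr => by
    have hJ := log_norm_le_circleAverage_log_max hf (by simpa only [hψ0] using hgθ) hr.1 hr.2 hη
    simp only [hψ0] at hJ
    refine hJ.trans ?_
    rw [Real.circleAverage_def, smul_eq_mul]
    refine mul_le_mul_of_nonneg_left ?_ (by positivity)
    rw [← intervalIntegral.integral_add_adjacent_intervals
      ((hu r hr).intervalIntegrable 0 (2 * α)) ((hu r hr).intervalIntegrable (2 * α) _),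
      intervalIntegral.integral_of_le (by positivity), integral_Ioc_eq_integral_Ioo]
    refine add_le_add (integral_Ioo_eq_integral_betaDensity h0 h1 (u r)).le ?_
    rw [← integral_Ioc_eq_integral_Ioo, ← intervalIntegral.integral_of_le (by linarith)]
    exact intervalIntegral.integral_mono_on (by linarith)
      ((hu r hr).intervalIntegrable _ _) ((hv r hr).intervalIntegrable _ _) fun φ _ => huv r hr φ
  have hlim1 : Filter.Tendsto
      (fun r => ∫ t, 2 * Real.pi * θ * betaDensity θ t * u r (boundaryAngle α t))
      (nhdsWithin 1 (Set.Iio 1))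
      (nhds (∫ t : ℝ, 2 * Real.pi * θ * betaDensity θ t *
        Real.log (max ‖g (1 + t * Complex.I)‖ η))) := by
    refine tendsto_integral_filter_of_dominated_convergence
      (fun t => 2 * Real.pi * θ * betaDensity θ t * K) ?_ ?_ ?_ ?_
    · filter_upwards [hnear] with r hr
      refine Continuous.aestronglyMeasurable ?_
      have hb : Continuous (boundaryAngle α) := continuous_iff_continuousAt.2 fun t =>
        (hasDerivAt_boundaryAngle h0 h1 t).continuousAt
      exact (continuous_const.mul (continuous_betaDensity h0 h1)).mul ((hu r hr).comp hb)
    · filter_upwards [hnear] with r hr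
      refine Filter.Eventually.of_forall fun t => ?_
      have := betaDensity_nonneg h0 h1 t
      rw [norm_mul, Real.norm_of_nonneg (by positivity)]
      exact mul_le_mul_of_nonneg_left (huK r hr _) (by positivity)
    · exact ((integrable_betaDensity h0 h1).const_mul _).mul_const _
    · refine Filter.Eventually.of_forall fun t => Filter.Tendsto.const_mul _ ?_
      have hmem : (1 + t * Complex.I : ℂ) ∈ {z : ℂ | 0 < z.re} := by simp
      have h2 := ((hg.continuousOn.continuousAt (hopen.mem_nhds hmem)).tendsto.comp
        (tendsto_diskToStrip_right hα0 hα1 t)).norm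
      exact (h2.max tendsto_const_nhds).log (hη.trans_le (le_max_right _ _)).ne'
  have hlim2 : Filter.Tendsto (fun r => ∫ φ in Set.Ioo (2 * α) (2 * Real.pi), v r φ)
      (nhdsWithin 1 (Set.Iio 1))
      (nhds (∫ φ in Set.Ioo (2 * α) (2 * Real.pi), Real.log (max (c 0) η))) := by
    refine tendsto_integral_filter_of_dominated_convergence (fun _ => K) ?_ ?_ ?_ ?_
    · filter_upwards [hnear] with r hr
      exact (hv r hr).aestronglyMeasurable
    · filter_upwards [hnear] with r hr
      exact Filter.Eventually.of_forall (hvK r hr)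
    · exact integrable_const K
    · refine ae_restrict_of_forall_mem measurableSet_Ioo fun φ hφ => ?_
      have h2 := (hc.tendsto 0).comp (tendsto_re_diskToStrip_left hα0 hα1 hφ.1 hφ.2)
      exact (h2.max tendsto_const_nhds).log (hη.trans_le (le_max_right _ _)).ne'
  have hfinal := ge_of_tendsto ((hlim1.add hlim2).const_mul (2 * Real.pi)⁻¹)
    (Filter.mem_of_superset hnear hineq)
  refine hfinal.trans (le_of_eq ?_)
  rw [setIntegral_const, measureReal_def, Real.volume_Ioo,
    ENNReal.toReal_ofReal (by linarith), smul_eq_mul]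
  simp_rw [mul_assoc (2 * Real.pi * θ)]
  rw [integral_const_mul, hα]
  generalize (∫ t : ℝ, betaDensity θ t * Real.log (max ‖g (1 + t * Complex.I)‖ η)) = I
  field_simp
  ring

/-! ### Interpolation of finite sums -/

theorem integrable_betaDensity_mul_log_max {θ : ℝ} (h0 : 0 < θ) (h1 : θ < 1) {S : ℝ → ℝ}
    (hS : Continuous S) {B : ℝ} (hB : ∀ t, S t ≤ B) {ε : ℝ} (hε : 0 < ε) :
    Integrable fun t => betaDensity θ t * Real.log (max (S t) ε) :=
  (integrable_betaDensity h0 h1).mul_bdd (continuous_log_max hS hε).aestronglyMeasurable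
    (Filter.Eventually.of_forall fun t => abs_log_max_le hε (hB t))

/-- Hölder's inequality with weights `a i ^ p`, in a form that includes `q = 1`. -/
theorem sum_rpow_mul_le_rpow_mul_rpow {ι : Type*} [Fintype ι] {q : ℝ} (hq : 1 ≤ q) (p : ℝ)
    {a y : ι → ℝ} (ha : ∀ i, 0 < a i) (hy : ∀ i, 0 ≤ y i) :
    ∑ i, a i ^ (p * (1 - 1 / q)) * y i ≤
      (∑ i, a i ^ p) ^ (1 - 1 / q) * (∑ i, y i ^ q) ^ (1 / q) := by
  have hq0 : q ≠ 0 := by positivity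
  have h := Real.inner_le_weight_mul_Lp_of_nonneg Finset.univ hq (fun i => a i ^ p)
    (fun i => a i ^ (-(p / q)) * y i) (fun i => Real.rpow_nonneg (ha i).le _)
    (fun i => mul_nonneg (Real.rpow_nonneg (ha i).le _) (hy i))
  rw [← one_div] at h
  convert h using 2
  · rw [← mul_assoc, ← Real.rpow_add (ha _)]
    congr 2
    ring
  · congr 1
    refine Finset.sum_congr rfl fun i _ => ?_
    rw [Real.mul_rpow (Real.rpow_nonneg (ha i).le _) (hy i), ← Real.rpow_mul (ha i).le,
      ← mul_assoc, ← Real.rpow_add (ha i), neg_mul, div_mul_cancel₀ _ hq0, add_neg_cancel,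
      Real.rpow_zero, one_mul]

/-- Complex interpolation between `ℓ^∞` at `Re z = 0` and `ℓ^q` at `Re z = 1`, for a finite family of
holomorphic functions: Hirschman's lemma applied to the function `g` which pairs `h` with the extremal
element of the dual space at `θ`, so that `g θ` is the sum of the `p`-th powers. -/
theorem log_sum_rpow_le_integral {ι : Type*} [Fintype ι] {h : ι → ℂ → ℂ}
    (hd : ∀ i, DifferentiableOn ℂ (h i) {z | 0 < z.re}) {M : ℝ} (hM : 1 ≤ M)
    (hb : ∀ i (z : ℂ), 0 < z.re → ‖h i z‖ ≤ M ^ z.re) {p q : ℝ} (hq : 1 ≤ q) (hqp : q < p)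
    (hne : ∀ i, h i (q / p : ℝ) ≠ 0) {ε : ℝ} (hε : 0 < ε)
    (hεN : ε ≤ ∑ i, ‖h i (q / p : ℝ)‖ ^ p) :
    Real.log (∑ i, ‖h i (q / p : ℝ)‖ ^ p) ≤
      ∫ t : ℝ, betaDensity (q / p) t *
        Real.log (max (∑ i, ‖h i (1 + t * Complex.I)‖ ^ q) ε) := by
  have hq0 : 0 < q := by linarith
  have hp0 : 0 < p := by linarith
  set θ := q / p with hθ
  have h0 : 0 < θ := div_pos hq0 hp0
  have h1 : θ < 1 := (div_lt_one hp0).2 hqp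
  set a : ι → ℝ := fun i => ‖h i (θ : ℝ)‖ with ha'
  have ha : ∀ i, 0 < a i := fun i => norm_pos_iff.2 (hne i)
  set N := ∑ i, a i ^ p with hN
  have hN0 : 0 < N := hε.trans_le hεN
  set S : ℝ → ℝ := fun t => ∑ i, ‖h i (1 + t * Complex.I)‖ ^ q with hS
  have hopen : IsOpen {z : ℂ | 0 < z.re} := isOpen_lt continuous_const Complex.continuous_re
  have hline : ∀ i, Continuous fun t : ℝ => h i (1 + t * Complex.I) := fun i =>
    (hd i).continuousOn.comp_continuous (by fun_prop) fun t => by simp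
  have hScont : Continuous S := continuous_finsetSum _ fun i _ =>
    (hline i).norm.rpow_const fun _ => Or.inr hq0.le
  have hSB : ∀ t, S t ≤ ∑ _i : ι, M ^ q := fun t => Finset.sum_le_sum fun i _ => by
    refine Real.rpow_le_rpow (norm_nonneg _) ?_ hq0.le
    simpa using hb i (1 + t * Complex.I) (by simp)
  -- the exponent is `p - 1` at `z = θ` and has real part `p` on the imaginary axis
  let g : ℂ → ℂ := fun z => ∑ i, (a i : ℂ) ^ (p * (1 - z / q)) *
    (starRingEnd ℂ (h i (θ : ℝ)) / a i) * h i z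
  have hac : ∀ i, (a i : ℂ) ≠ 0 := fun i => by exact_mod_cast (ha i).ne'
  have hpow : ∀ i (z : ℂ), ‖(a i : ℂ) ^ (p * (1 - z / q)) *
      (starRingEnd ℂ (h i (θ : ℝ)) / a i) * h i z‖ = a i ^ (p * (1 - z.re / q)) * ‖h i z‖ := by
    intro i z
    have e1 : ((p : ℂ) * (1 - z / q)).re = p * (1 - z.re / q) := by
      rw [Complex.re_ofReal_mul, Complex.sub_re, Complex.one_re, Complex.div_ofReal_re]
    rw [norm_mul, norm_mul, norm_div, RCLike.norm_conj, Complex.norm_real,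
      Real.norm_of_nonneg (ha i).le, Complex.norm_cpow_eq_rpow_re_of_pos (ha i), e1,
      div_self (ha i).ne', mul_one]
  have hg : DifferentiableOn ℂ g {z | 0 < z.re} := by
    refine DifferentiableOn.fun_sum fun i _ => DifferentiableOn.mul ?_ (hd i)
    refine (DifferentiableOn.const_cpow (by fun_prop) (Or.inl (hac i))).mul_const _
  let c : ℝ → ℝ := fun x => ∑ i, a i ^ (p * (1 - x / q)) * M ^ x
  have hc : Continuous c := by
    refine continuous_finsetSum _ fun i _ => Continuous.mul ?_ ?_
    · exact Continuous.rpow continuous_const (by fun_prop) fun x => Or.inl (ha i).ne'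
    · exact Continuous.rpow continuous_const continuous_id fun x => Or.inl (by positivity)
  have hgc : ∀ z : ℂ, 0 < z.re → ‖g z‖ ≤ c z.re := fun z hz => by
    refine (norm_sum_le _ _).trans (Finset.sum_le_sum fun i _ => ?_)
    rw [hpow]
    exact mul_le_mul_of_nonneg_left (hb i z hz) (Real.rpow_nonneg (ha i).le _)
  have hc0 : c 0 = N := by simp [c, hN]
  have hgθ : g θ = N := by
    simp only [g, hN, Complex.ofReal_sum]
    refine Finset.sum_congr rfl fun i _ => ?_
    have e1 : (p : ℂ) * (1 - (θ : ℂ) / q) = ((p - 1 : ℝ) : ℂ) := by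
      rw [hθ]
      have : (p : ℂ) ≠ 0 := by exact_mod_cast hp0.ne'
      have : (q : ℂ) ≠ 0 := by exact_mod_cast hq0.ne'
      push_cast
      field_simp
    have e2 : starRingEnd ℂ (h i (θ : ℝ)) / a i * h i (θ : ℝ) = a i := by
      rw [div_mul_eq_mul_div, Complex.conj_mul', div_eq_iff (hac i)]
      simp only [ha']
      ring
    rw [mul_assoc, e2, e1, ← Complex.ofReal_cpow (ha i).le, ← Complex.ofReal_mul,
      ← Real.rpow_add_one (ha i).ne', sub_add_cancel]
  -- with this `η` the term `N ^ (1 - 1 / q)` can be factored out of `max ‖g‖ η`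
  set η := N ^ (1 - 1 / q) * ε ^ (1 / q) with hη'
  have hη : 0 < η := by positivity
  have hηN : η ≤ N := by
    calc η ≤ N ^ (1 - 1 / q) * N ^ (1 / q) := by
          refine mul_le_mul_of_nonneg_left ?_ (by positivity)
          exact Real.rpow_le_rpow hε.le hεN (by positivity)
      _ = N := by rw [← Real.rpow_add hN0, sub_add_cancel, Real.rpow_one]
  have hmain := log_norm_le_integral_betaDensity h0 h1 hg hc (fun z hz _ => hgc z hz)
    (by rw [hgθ]; exact_mod_cast hN0.ne') hη
  rw [hgθ, hc0, max_eq_left hηN, Complex.norm_real, Real.norm_of_nonneg hN0.le] at hmain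
  have hSint := integrable_betaDensity_mul_log_max h0 h1 hScont hSB hε
  have hpt : ∀ t : ℝ, Real.log (max ‖g (1 + t * Complex.I)‖ η) ≤
      (1 - 1 / q) * Real.log N + 1 / q * Real.log (max (S t) ε) := fun t => by
    have hm : 0 < max (S t) ε := hε.trans_le (le_max_right _ _)
    have hS0 : 0 ≤ S t := Finset.sum_nonneg fun i _ => Real.rpow_nonneg (norm_nonneg _) _
    rw [← Real.log_rpow hN0, ← Real.log_rpow hm, ← Real.log_mul (by positivity) (by positivity)]
    refine Real.log_le_log (hη.trans_le (le_max_right _ _)) (max_le ?_ ?_)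
    · refine (norm_sum_le _ _).trans ?_
      simp_rw [hpow]
      have e1 : (1 + t * Complex.I : ℂ).re = 1 := by simp
      rw [e1]
      refine (sum_rpow_mul_le_rpow_mul_rpow hq p ha fun i => norm_nonneg _).trans ?_
      refine mul_le_mul_of_nonneg_left ?_ (by positivity)
      exact Real.rpow_le_rpow hS0 (le_max_left _ _) (by positivity)
    · refine mul_le_mul_of_nonneg_left ?_ (by positivity)
      exact Real.rpow_le_rpow hε.le (le_max_right _ _) (by positivity)
  have hβ := integrable_betaDensity h0 h1
  have hle : ∫ t : ℝ, betaDensity θ t * Real.log (max ‖g (1 + t * Complex.I)‖ η) ≤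
      (1 - 1 / q) * Real.log N +
        1 / q * ∫ t : ℝ, betaDensity θ t * Real.log (max (S t) ε) := by
    have hrhs : (1 - 1 / q) * Real.log N +
        1 / q * (∫ t : ℝ, betaDensity θ t * Real.log (max (S t) ε)) =
        ∫ t : ℝ, (betaDensity θ t * ((1 - 1 / q) * Real.log N) +
          1 / q * (betaDensity θ t * Real.log (max (S t) ε))) := by
      rw [integral_add (hβ.mul_const _) (hSint.const_mul _), integral_mul_const,
        integral_betaDensity h0 h1, integral_const_mul, one_mul]
    rw [hrhs]
    have hint : Integrable fun t : ℝ =>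
        betaDensity θ t * Real.log (max ‖g (1 + t * Complex.I)‖ η) := by
      refine integrable_betaDensity_mul_log_max h0 h1 (B := c 1)
        (hg.continuousOn.comp_continuous (by fun_prop) fun t => by simp).norm (fun t => ?_) hη
      simpa using hgc (1 + t * Complex.I) (by simp)
    refine integral_mono hint ((hβ.mul_const _).add (hSint.const_mul _)) fun t => ?_
    have := mul_le_mul_of_nonneg_left (hpt t) (betaDensity_nonneg h0 h1 t)
    simp only
    linarith
  set I := ∫ t : ℝ, betaDensity θ t * Real.log (max (S t) ε)
  have h2 : Real.log N ≤ (1 - θ) * Real.log N + θ * ((1 - 1 / q) * Real.log N + 1 / q * I) := by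
    refine hmain.trans ?_
    gcongr
  have h3 : θ / q * Real.log N ≤ θ / q * I := by
    have e : (1 - θ) * Real.log N + θ * ((1 - 1 / q) * Real.log N + 1 / q * I) =
      Real.log N - θ / q * Real.log N + θ / q * I := by ring
    linarith
  exact le_of_mul_le_mul_left h3 (by positivity)

/-! ### Integrals of extended reals -/

theorem extIntegral_mono {f g : ℝ → EReal} (h : ∀ t, f t ≤ g t) :
    extIntegral f ≤ extIntegral g := by
  refine EReal.sub_le_sub ?_ ?_
  · exact EReal.coe_ennreal_le_coe_ennreal_iff.2
      (lintegral_mono fun t => EReal.toENNReal_le_toENNReal (h t))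
  · exact EReal.coe_ennreal_le_coe_ennreal_iff.2
      (lintegral_mono fun t => EReal.toENNReal_le_toENNReal (EReal.neg_le_neg_iff.2 (h t)))

theorem coe_mul_log_ofReal (b : ℝ) {s : ℝ} (hs : 0 < s) :
    (b : EReal) * ENNReal.log (ENNReal.ofReal s) = ((b * Real.log s : ℝ) : EReal) := by
  rw [ENNReal.log_ofReal_of_pos hs, EReal.coe_mul]

theorem ofReal_mul_log_max {b s ε : ℝ} (hb : 0 ≤ b) (hε : 0 < ε) (hε1 : ε ≤ 1) :
    ENNReal.ofReal (b * Real.log (max s ε)) =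
      ((b : EReal) * ENNReal.log (ENNReal.ofReal s)).toENNReal := by
  rcases le_total ε s with h | h
  · rw [max_eq_left h, coe_mul_log_ofReal b (hε.trans_le h), EReal.real_coe_toENNReal]
  · rw [max_eq_right h, EReal.toENNReal_of_nonpos, ENNReal.ofReal_of_nonpos]
    · exact mul_nonpos_of_nonneg_of_nonpos hb (Real.log_nonpos hε.le hε1)
    · refine mul_nonpos_of_nonneg_of_nonpos (EReal.coe_nonneg.2 hb) ?_
      rw [← ENNReal.log_one]
      exact ENNReal.log_monotone (ENNReal.ofReal_le_one.2 (h.trans hε1))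

/-- The cut-off negative parts converge to the negative part in `[0, ∞]`, also where `s = 0` and
`log s = -∞`. -/
theorem tendsto_ofReal_neg_mul_log_max (b : ℝ) {s : ℝ} (hs : 0 ≤ s) {ε : ℕ → ℝ}
    (hε : ∀ n, 0 < ε n) (hlim : Filter.Tendsto ε Filter.atTop (nhds 0)) :
    Filter.Tendsto (fun n => ENNReal.ofReal (-(b * Real.log (max s (ε n))))) Filter.atTop
      (nhds (-((b : EReal) * ENNReal.log (ENNReal.ofReal s))).toENNReal) := by
  have h1 : ∀ n, ENNReal.ofReal (-(b * Real.log (max s (ε n)))) =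
      (-((b : EReal) * ENNReal.log (ENNReal.ofReal (max s (ε n))))).toENNReal := fun n => by
    rw [coe_mul_log_ofReal b ((hε n).trans_le (le_max_right _ _)), ← EReal.coe_neg,
      EReal.real_coe_toENNReal]
  simp_rw [h1]
  have h2 : Filter.Tendsto (fun n => ENNReal.log (ENNReal.ofReal (max s (ε n)))) Filter.atTop
      (nhds (ENNReal.log (ENNReal.ofReal s))) := by
    have h3 : Filter.Tendsto (fun n => max s (ε n)) Filter.atTop (nhds s) := by
      simpa [max_eq_left hs] using (tendsto_const_nhds (x := s)).max hlim
    exact (ENNReal.continuous_log.tendsto _).comp ((ENNReal.continuous_ofReal.tendsto _).comp h3)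
  have h4 : Filter.Tendsto (fun n => (b : EReal) * ENNReal.log (ENNReal.ofReal (max s (ε n))))
      Filter.atTop (nhds ((b : EReal) * ENNReal.log (ENNReal.ofReal s))) := by
    exact EReal.Tendsto.const_mul h2 (Or.inl (EReal.coe_ne_bot b)) (Or.inl (EReal.coe_ne_top b))
  exact (EReal.continuous_toENNReal.tendsto _).comp ((continuous_neg.tendsto _).comp h4)

/-- Removal of the cut-off. The positive part of the integral does not change for `ε ≤ 1`, so the
hypothesis bounds the negative parts, and Fatou's lemma bounds their limit; in particular the case
`∞ - ∞` does not occur. -/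
theorem coe_le_extIntegral {β S : ℝ → ℝ} (hβ : ∀ t, 0 ≤ β t) (hβm : Measurable β)
    (hSm : Measurable S) (hS : ∀ t, 0 ≤ S t)
    (hint : ∀ ε, 0 < ε → Integrable fun t => β t * Real.log (max (S t) ε)) {x δ : ℝ} (hδ : 0 < δ)
    (hx : ∀ ε, 0 < ε → ε ≤ δ → x ≤ ∫ t, β t * Real.log (max (S t) ε)) :
    (x : EReal) ≤ extIntegral fun t => (β t : EReal) * ENNReal.log (ENNReal.ofReal (S t)) := by
  set ε : ℕ → ℝ := fun n => min δ 1 * (1 / ((n : ℝ) + 1)) with hεdef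
  have hm : 0 < min δ 1 := lt_min hδ one_pos
  have hε0 : ∀ n, 0 < ε n := fun n => by positivity
  have hεm : ∀ n, ε n ≤ min δ 1 := fun n => by
    refine mul_le_of_le_one_right hm.le ?_
    rw [div_le_one (by positivity)]
    linarith [n.cast_nonneg (α := ℝ)]
  have hlim : Filter.Tendsto ε Filter.atTop (nhds 0) := by
    rw [hεdef, ← mul_zero (min δ 1)]
    exact (tendsto_one_div_add_atTop_nhds_zero_nat (𝕜 := ℝ)).const_mul (min δ 1)
  set P := ∫⁻ t, ((β t : EReal) * ENNReal.log (ENNReal.ofReal (S t))).toENNReal with hP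
  set Q := ∫⁻ t, (-((β t : EReal) * ENNReal.log (ENNReal.ofReal (S t)))).toENNReal with hQ
  let q : ℕ → ℝ≥0∞ := fun n => ∫⁻ t, ENNReal.ofReal (-(β t * Real.log (max (S t) (ε n))))
  have hPn : ∀ n, ∫⁻ t, ENNReal.ofReal (β t * Real.log (max (S t) (ε n))) = P := fun n =>
    lintegral_congr fun t =>
      ofReal_mul_log_max (hβ t) (hε0 n) ((hεm n).trans (min_le_right _ _))
  have hPfin : P ≠ ∞ := by
    rw [← hPn 0]
    exact (hint _ (hε0 0)).lintegral_lt_top.ne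
  have hqfin : ∀ n, q n ≠ ∞ := fun n => (hint _ (hε0 n)).neg.lintegral_lt_top.ne
  have hq : ∀ n, q n ≤ ENNReal.ofReal (P.toReal - x) := fun n => by
    have h := hx _ (hε0 n) ((hεm n).trans (min_le_left _ _))
    rw [integral_eq_lintegral_pos_part_sub_lintegral_neg_part (hint _ (hε0 n)), hPn] at h
    exact (ENNReal.le_ofReal_iff_toReal_le (hqfin n)
      (by linarith [ENNReal.toReal_nonneg (a := q n)])).2 (by linarith)
  have hpos : 0 ≤ P.toReal - x := by
    have h := hx _ (hε0 0) ((hεm 0).trans (min_le_left _ _))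
    rw [integral_eq_lintegral_pos_part_sub_lintegral_neg_part (hint _ (hε0 0)), hPn] at h
    linarith [ENNReal.toReal_nonneg (a := q 0)]
  -- Fatou's lemma as `ε n → 0`
  have hQle : Q ≤ ENNReal.ofReal (P.toReal - x) := by
    calc Q = ∫⁻ t, Filter.liminf
            (fun n => ENNReal.ofReal (-(β t * Real.log (max (S t) (ε n))))) Filter.atTop :=
          lintegral_congr fun t =>
            (tendsto_ofReal_neg_mul_log_max (β t) (hS t) hε0 hlim).liminf_eq.symm
      _ ≤ Filter.liminf q Filter.atTop := lintegral_liminf_le fun n => by fun_prop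
      _ ≤ ENNReal.ofReal (P.toReal - x) := by
          refine (Filter.liminf_le_liminf (Filter.Eventually.of_forall hq)).trans ?_
          simp
  have hQfin : Q ≠ ∞ := (hQle.trans_lt ENNReal.ofReal_lt_top).ne
  have hfin : x ≤ P.toReal - Q.toReal := by
    have := ENNReal.toReal_le_of_le_ofReal hpos hQle
    linarith
  change (x : EReal) ≤ (P : EReal) - (Q : EReal)
  rw [← EReal.coe_ennreal_toReal hPfin, ← EReal.coe_ennreal_toReal hQfin, ← EReal.coe_sub]
  exact EReal.coe_le_coe_iff.2 hfin

/-! ### The trace inequality -/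

section Operators

variable {H : Type*} [NormedAddCommGroup H] [InnerProductSpace ℂ H] [CompleteSpace H]

theorem schattenNorm_rpow {p : ℝ} (hp : p ≠ 0) (X : H →L[ℂ] H) :
    schattenNorm p X ^ p = posTrace (cfc (fun x : ℝ => x ^ p) (CFC.abs X)) := by
  rw [schattenNorm, ← ENNReal.rpow_mul, one_div_mul_cancel hp, ENNReal.rpow_one]

/-- Interpolation for the matrix entries `z ↦ ⟪V (e i), C₁ ^ (z / q) ⋯ C_L ^ (z / q) (e i)⟫`, at
`θ = q / p`. -/
theorem log_ofReal_sum_rpow_le_extIntegral {L : ℕ} {C : Fin L → H →L[ℂ] H} (hC : ∀ i, 0 ≤ C i)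
    {p q : ℝ} (hq : 1 ≤ q) (hqp : q < p) {ι : Type*} [Fintype ι] {e : ι → H}
    (he : Orthonormal ℂ e) {V : H →L[ℂ] H} (hV : ‖V‖ ≤ 1)
    (hne : ∀ i, ⟪V (e i), chainPow C (1 / (p : ℂ)) (e i)⟫_ℂ ≠ 0)
    (hpos : 0 < ∑ i, ‖⟪V (e i), chainPow C (1 / (p : ℂ)) (e i)⟫_ℂ‖ ^ p) :
    ENNReal.log (ENNReal.ofReal (∑ i, ‖⟪V (e i), chainPow C (1 / (p : ℂ)) (e i)⟫_ℂ‖ ^ p)) ≤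
      extIntegral fun t : ℝ => (betaDensity (q / p) t : EReal) *
        ENNReal.log (posTrace (cfc (fun x : ℝ => x ^ q)
          (CFC.abs (chainPow C ((1 + t * Complex.I) / (q : ℂ)))))) := by
  have hq0 : 0 < q := by linarith
  have hp0 : 0 < p := by linarith
  have h0 : 0 < q / p := div_pos hq0 hp0
  have h1 : q / p < 1 := (div_lt_one hp0).2 hqp
  have hβ := betaDensity_nonneg h0 h1
  let h : ι → ℂ → ℂ := fun i z => ⟪V (e i), chainPow C (z / q) (e i)⟫_ℂ
  have hre : ∀ z : ℂ, 0 < z.re → 0 < (z / q).re := fun z hz => by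
    rw [Complex.div_ofReal_re]
    positivity
  have hd : ∀ i, DifferentiableOn ℂ (h i) {z | 0 < z.re} := fun i => by
    have h2 : DifferentiableOn ℂ (fun z : ℂ => chainPow C (z / q)) {z | 0 < z.re} :=
      (differentiableOn_chainPow hC).comp (by fun_prop) fun z hz => hre z hz
    exact ((innerSL ℂ (V (e i))).differentiable.comp_differentiableOn
      (h2.clm_apply (differentiableOn_const (e i))))
  obtain ⟨M, hM1, hM⟩ := exists_norm_chainPow_le hC
  have hb : ∀ i (z : ℂ), 0 < z.re → ‖h i z‖ ≤ M ^ z.re := fun i z hz => by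
    calc ‖h i z‖ ≤ ‖V (e i)‖ * ‖chainPow C (z / q) (e i)‖ := norm_inner_le_norm _ _
      _ ≤ 1 * ‖chainPow C (z / q)‖ := by
          gcongr
          · simpa [he.1 i] using (V.le_opNorm (e i)).trans
              (mul_le_of_le_one_left (norm_nonneg _) hV)
          · simpa [he.1 i] using (chainPow C (z / q)).le_opNorm (e i)
      _ ≤ M ^ (z / q).re := by rw [one_mul]; exact hM _ (hre z hz)
      _ ≤ M ^ z.re := by
          refine Real.rpow_le_rpow_of_exponent_le hM1 ?_
          rw [Complex.div_ofReal_re]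
          exact div_le_self hz.le hq
  have hθ : ∀ i, h i ((q / p : ℝ) : ℂ) = ⟪V (e i), chainPow C (1 / (p : ℂ)) (e i)⟫_ℂ := fun i => by
    have : (((q / p : ℝ) : ℂ) / q) = 1 / (p : ℂ) := by
      have : (q : ℂ) ≠ 0 := by exact_mod_cast hq0.ne'
      push_cast
      field_simp
    simp only [h, this]
  have hline : ∀ i, Continuous fun t : ℝ => h i (1 + t * Complex.I) := fun i =>
    (hd i).continuousOn.comp_continuous (by fun_prop) fun t => by simp
  have hScont : Continuous fun t : ℝ => ∑ i, ‖h i (1 + t * Complex.I)‖ ^ q :=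
    continuous_finsetSum _ fun i _ => (hline i).norm.rpow_const fun _ => Or.inr hq0.le
  have hSB : ∀ t : ℝ, ∑ i, ‖h i (1 + t * Complex.I)‖ ^ q ≤ ∑ _i : ι, M ^ q := fun t =>
    Finset.sum_le_sum fun i _ => by
      refine Real.rpow_le_rpow (norm_nonneg _) ?_ hq0.le
      simpa using hb i (1 + t * Complex.I) (by simp)
  simp_rw [← hθ] at hne hpos ⊢
  rw [ENNReal.log_ofReal_of_pos hpos]
  refine (coe_le_extIntegral hβ (continuous_betaDensity h0 h1).measurable hScont.measurable
    (fun t => Finset.sum_nonneg fun i _ => Real.rpow_nonneg (norm_nonneg _) _)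
    (fun ε hε => integrable_betaDensity_mul_log_max h0 h1 hScont hSB hε) hpos
    fun ε hε hεN => log_sum_rpow_le_integral hd hM1 hb hq hqp hne hε hεN).trans ?_
  refine extIntegral_mono fun t => ?_
  refine mul_le_mul_of_nonneg_left (ENNReal.log_monotone ?_) (EReal.coe_nonneg.2 (hβ t))
  exact sum_norm_inner_rpow_le_posTrace _ hq he hV

end Operators

theorem theorem2 {H : Type*} [NormedAddCommGroup H] [InnerProductSpace ℂ H] [CompleteSpace H]
    {L : ℕ} (C : Fin L → H →L[ℂ] H) (hC : ∀ i, (C i).IsPositive)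
    {p q : ℝ} (hq : 1 ≤ q) (hqp : q < p) :
    ((∀ t, 0 ≤ betaDensity (q / p) t) ∧ Integrable (betaDensity (q / p)) ∧
      ∫ t, betaDensity (q / p) t = 1) ∧
    ENNReal.log (schattenNorm p (chainPow C (1 / (p : ℂ))) ^ p) ≤
      extIntegral fun t : ℝ =>
        (betaDensity (q / p) t : EReal) *
          ENNReal.log (schattenNorm q (chainPow C ((1 + t * Complex.I) / (q : ℂ))) ^ q) := by
  have hq0 : 0 < q := by linarith
  have hp0 : 0 < p := by linarith
  have h0 : 0 < q / p := div_pos hq0 hp0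
  have h1 : q / p < 1 := (div_lt_one hp0).2 hqp
  refine ⟨⟨betaDensity_nonneg h0 h1, integrable_betaDensity h0 h1,
    integral_betaDensity h0 h1⟩, ?_⟩
  simp_rw [schattenNorm_rpow hq0.ne', schattenNorm_rpow hp0.ne']
  refine le_of_forall_lt fun y hy => ?_
  rw [← EReal.log_exp y, ENNReal.log_lt_log_iff] at hy
  obtain ⟨J, hJ, e, V, he, hV, hne, hlt⟩ := exists_lt_sum_norm_inner_rpow _ (hq.trans hqp.le) hy
  rw [← EReal.log_exp y]
  refine (ENNReal.log_lt_log_iff.2 hlt).trans_le ?_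
  exact log_ofReal_sum_rpow_le_extIntegral
    (fun i => (ContinuousLinearMap.nonneg_iff_isPositive _).2 (hC i)) hq hqp he hV hne
    (ENNReal.ofReal_pos.1 (pos_of_gt hlt))
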